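/- **Setting.** Consider $x_{t+1}=A(\theta^\ast)x_t+B(\theta^\ast)u_t+w_t$, $x_t\in\mathbb R^{n_x}$, $u_t\in\mathbb R^{n_u}$, with $(A(\theta),B(\theta))=(A_0,B_0)+\sum_{i=1}^p[\theta]_i(A_i,B_i)$, constant unknown $\theta^\ast\in\Theta_0$, disturbances $w_t\in\mathcal W=\{w:\Pi_w w\le\pi_w\}$ and constraints $Fx_t+Gu_t\le\mathbf 1$. Write $\Theta(\mu)=\{\theta: M_\Theta\theta\le\mu\}$, $\Theta_0=\Theta(\mu_0)$, $\Phi(\theta)=A(\theta)+B(\theta)K$, $D(x,u)=[A_1x+B_1u\ \cdots\ A_px+B_pu]$, $d(x,u)=A_0x+B_0u$. Assume: 1. $\mathcal W$ is compact and $\pi_w>0$; $\Theta_0$ is bounded; $\mathcal Z=\{(x,u):Fx+Gu\le\mathbf 1\}$ is compact with the origin in its interior; $Q,R\succ0$; the horizon $N$ and the window length $N_u$ are at least $1$. 2. $\mathcal X=\{x:Tx\le\mathbf 1\}$ is bounded, has no redundant inequality, and for some $\lambda\in[0,1)$, $T\Phi(\theta)x\le\lambda\mathbf 1$ for all $x\in\mathcal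 X$, $\theta\in\Theta_0$. 3. The matrices $U_1,\dots,U_m$ and index sets $\mathcal R_1,\dots,\mathcal R_m$, $|\mathcal R_j|=n_x$, satisfy $[T]_iU_j=[\mathcal I]_i$ for $i\in\mathcal R_j$, and $\{x:Tx\le\alpha\}=\mathrm{Co}\{U_1\alpha,\dots,U_m\alpha\}$ for every $\alpha$ such that each of the inequalities $[T]_ix\le[\alpha]_i$ is attained with equality at some point of $\{x:Tx\le\alpha\}$. Let $[\bar w]_i=\max_{w\in\mathcal W}[Tw]_i$ and let $P(\theta)$ solve $P-\Phi(\theta)^\top P\,\Phi(\theta)=Q+K^\top RK$ ($\theta\in\Theta_0$). **Problem $\mathcal P$** (with data $x$, $\bar\theta$, $\mu$ and reference sequences $\hat x_k,\hat u_k$): minimize $\sum_{k=0}^{N-1}(\|\bar x_k\|_Q^2+\|\bar u_k\|_R^2)+\|\bar x_N\|^2_{P(\bar\theta)}-\gamma\beta$ over $v_k,\alpha_k,\bar x_k,\bar u_k,\beta,\Lambda_{k,j},M_k$, with $v_k=0$, $\alpha_k=\alpha_N$ for $k\ge N$, subject to - $Tx\le\alpha_0$; $(F+GK)U_j\alpha_k+Gv_k\le\mathbf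 1$ for all $j$ and all $k\le N$; - for all $j$ and all $k\le N$: $\Lambda_{k,j}\ge0$ (entrywise), $\Lambda_{k,j}M_\Theta=T\,D(U_j\alpha_k,KU_j\alpha_k+v_k)$, $\Lambda_{k,j}\mu\le\alpha_{k+1}-T\,d(U_j\alpha_k,KU_j\alpha_k+v_k)-\bar w$; - $\bar x_0=x$, $\bar x_{k+1}=\Phi(\bar\theta)\bar x_k+B(\bar\theta)v_k$, $\bar u_k=K\bar x_k+v_k$; - for all $j$ and all $k<N_u$, with $\hat D_k=D(\hat x_k,\hat u_k)$ and $\tilde D_{k,j}=D(U_j\alpha_k-\hat x_k,KU_j\alpha_k+v_k-\hat u_k)$: $\hat D_k^\top\hat D_k+\tilde D_{k,j}^\top\hat D_k+\hat D_k^\top\tilde D_{k,j}\succeq M_k$, and $\sum_{k<N_u}M_k\succeq\beta\mathcal I$. **Closed loop.** For $t\ge1$, $\Theta_t=\Theta(\mu_t)$ is the smallest set of this form, i.e. $\mu_t$ is the componentwise least vector $\mu$ with $\Theta(\mu)\supseteq\Theta_{t-1}\cap\bigcap_{j=\max(1,t-N_u+1)}^{t}\Delta_j$, where $\Delta_j=\{\theta:x_j-A(\theta)x_{j-1}-B(\theta)u_{j-1}\in\mathcal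 W\}$. The reference at $t=0$ is given by an arbitrary rule depending on $x_0$; at $t\ge1$ it is $\hat x_0=x_t$, $\hat x_{k+1}=A(\bar\theta_t)\hat x_k+B(\bar\theta_t)\hat u_k$, $\hat u_k=K\hat x_k+\hat v_k$, with $\hat v_k=v^\ast_{k+1|t-1}$ for $k\le N-2$ and $\hat v_k=0$ for $k\ge N-1$. At each $t$, $\mathcal P$ is solved for $x=x_t$, $\bar\theta=\bar\theta_t$, $\mu=\mu_t$, with an optimal $\mathbf v^\ast_t=(v^\ast_{0|t},\dots,v^\ast_{N-1|t})$, and $u_t=Kx_t+v^\ast_{0|t}$ is applied. Let $X_{\mathcal P}$ be the set of initial states $x_0$ for which $\mathcal P$ is feasible at $t=0$. **Theorem.** Let $\gamma=0$. There are a $\mathcal{KL}$-function $\eta$ and $\mathcal K$-functions $\psi,\zeta$, which depend only on the data fixed above, such that for every $\bar\theta_0\in\Theta_0$, with the nominal parameter kept fixed, $\bar\theta_t=\bar\theta_0$ for all $t$, and every initial reference rule, if $X_{\mathcal P}\ne\emptyset$, then $0$ is an interior point of $X_{\mathcal P}$, and for every $\theta^\ast\in\Theta_0$, every sequence $w_t\in\mathcal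 W$ and every $x_0\in X_{\mathcal P}$ the following hold. (a) The closed loop is well defined for all times: it has a trajectory from $x_0$, along which $\mathcal P$ is feasible and has an optimal solution at every $t\ge0$. (b) Every closed-loop trajectory from $x_0$ satisfies $Fx_t+Gu_t\le\mathbf 1$ for all $t\ge0$ (robust constraint satisfaction). (c) The closed loop is input-to-state stable with region of attraction $X_{\mathcal P}$: every closed-loop trajectory from $x_0$ satisfies, for all $t\ge0$, $$\|x_t\|\le\eta(\|x_0\|,t)+\psi\Bigl(\max_{0\le k\le t-1}\|w_k\|\Bigr)+\zeta\Bigl(\max_{0\le k\le t-1}\|\bar\theta_k-\theta^\ast\|\Bigr),$$ where $\|\cdot\|$ is the Euclidean norm and the maxima are $0$ for $t=0$. -/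

import Mathlib

open scoped Matrix NNReal Topology
open Filter

noncomputable section

namespace AdaptiveMPC

/-! ## Comparison functions -/

/-- Class `K`: continuous, strictly increasing, zero at zero. -/
def IsClassK (σ : ℝ≥0 → ℝ≥0) : Prop :=
  Continuous σ ∧ StrictMono σ ∧ σ 0 = 0

/-- Class `KL`: jointly continuous, of class `K` in the first argument, and decreasing to zero in
the second one. -/
def IsClassKL (φ : ℝ≥0 → ℝ≥0 → ℝ≥0) : Prop :=
  Continuous (fun q : ℝ≥0 × ℝ≥0 => φ q.1 q.2) ∧
  (∀ t, IsClassK fun s => φ s t) ∧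
  ∀ s, Antitone (φ s) ∧ Tendsto (φ s) atTop (𝓝 0)

/-- The Euclidean norm of a coordinate vector. -/
def euclNorm {n : ℕ} (x : Fin n → ℝ) : ℝ≥0 := ‖WithLp.toLp 2 x‖₊

/-- The weighted square `‖x‖²_P = xᵀ P x`. -/
def wsq {n : ℕ} (P : Matrix (Fin n) (Fin n) ℝ) (x : Fin n → ℝ) : ℝ := x ⬝ᵥ (P *ᵥ x)

/-! ## Data of the controller -/

/-- All data of the uncertain system and of the tube MPC controller (no assumption on them here).
The dimensions are those of the state, the input, the parameter, the number of constraints, and the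
numbers of rows of `PiW`, `MΘ`, `T`; `m` is the number of tube vertices. -/
structure Design (nx nu p nc nw r na m : ℕ) where
  /-- affine model `A(θ) = A0 + ∑ θᵢ Aᵢ`, `B(θ) = B0 + ∑ θᵢ Bᵢ` -/
  A0 : Matrix (Fin nx) (Fin nx) ℝ
  A : Fin p → Matrix (Fin nx) (Fin nx) ℝ
  B0 : Matrix (Fin nx) (Fin nu) ℝ
  B : Fin p → Matrix (Fin nx) (Fin nu) ℝ
  /-- constraints `F x + G u ≤ 1` -/
  F : Matrix (Fin nc) (Fin nx) ℝ
  G : Matrix (Fin nc) (Fin nu) ℝ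
  /-- disturbance set `{w | PiW w ≤ piw}` -/
  PiW : Matrix (Fin nw) (Fin nx) ℝ
  piw : Fin nw → ℝ
  /-- parameter sets `{θ | MΘ θ ≤ μ}`, with `μ = mu0` initially -/
  MΘ : Matrix (Fin r) (Fin p) ℝ
  mu0 : Fin r → ℝ
  /-- tube directions, feedback gain, cost weights -/
  T : Matrix (Fin na) (Fin nx) ℝ
  K : Matrix (Fin nu) (Fin nx) ℝ
  Q : Matrix (Fin nx) (Fin nx) ℝ
  R : Matrix (Fin nu) (Fin nu) ℝ
  /-- vertex matrices `U j` and their active index sets `Ract j` -/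
  U : Fin m → Matrix (Fin nx) (Fin na) ℝ
  Ract : Fin m → Finset (Fin na)
  /-- prediction horizon and length of the estimation (PE) window -/
  N : ℕ
  Nu : ℕ

variable {nx nu p nc nw r na m : ℕ}

namespace Design

variable (d : Design nx nu p nc nw r na m)

/-- `A(θ)` -/
def Aθ (θ : Fin p → ℝ) : Matrix (Fin nx) (Fin nx) ℝ := d.A0 + ∑ i, θ i • d.A i

/-- `B(θ)` -/
def Bθ (θ : Fin p → ℝ) : Matrix (Fin nx) (Fin nu) ℝ := d.B0 + ∑ i, θ i • d.B i

/-- `Φ(θ) = A(θ) + B(θ) K` -/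
def Phi (θ : Fin p → ℝ) : Matrix (Fin nx) (Fin nx) ℝ := d.Aθ θ + d.Bθ θ * d.K

/-- The regressor `D(x,u) = [A₁ x + B₁ u, …, A_p x + B_p u]`. -/
def regD (x : Fin nx → ℝ) (u : Fin nu → ℝ) : Matrix (Fin nx) (Fin p) ℝ :=
  Matrix.of fun i l => (d.A l *ᵥ x + d.B l *ᵥ u) i

/-- `d(x,u) = A₀ x + B₀ u` -/
def regd (x : Fin nx → ℝ) (u : Fin nu → ℝ) : Fin nx → ℝ := d.A0 *ᵥ x + d.B0 *ᵥ u

/-- The disturbance set. -/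
def W : Set (Fin nx → ℝ) := {w | d.PiW *ᵥ w ≤ d.piw}

/-- The parameter set `Θ(μ)`. -/
def Theta (μ : Fin r → ℝ) : Set (Fin p → ℝ) := {θ | d.MΘ *ᵥ θ ≤ μ}

/-- The state and input constraint set. -/
def Z : Set ((Fin nx → ℝ) × (Fin nu → ℝ)) := {z | d.F *ᵥ z.1 + d.G *ᵥ z.2 ≤ 1}

/-- The tube cross-section `{x | T x ≤ α}`. -/
def X (α : Fin na → ℝ) : Set (Fin nx → ℝ) := {x | d.T *ᵥ x ≤ α}

/-- `wbar i = max_{w ∈ W} [T w]ᵢ` -/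
def wbar : Fin na → ℝ := fun i => sSup ((fun w => (d.T *ᵥ w) i) '' d.W)

/-- The solution `P(θ)` of `P - Φ(θ)ᵀ P Φ(θ) = Q + Kᵀ R K`. -/
def lyapP (θ : Fin p → ℝ) : Matrix (Fin nx) (Fin nx) ℝ :=
  Classical.epsilon fun P => P - (d.Phi θ)ᵀ * P * d.Phi θ = d.Q + d.Kᵀ * d.R * d.K

/-- The standing assumptions. -/
structure Standing : Prop where
  N_pos : 0 < d.N
  Nu_pos : 0 < d.Nu
  /-- additive disturbance -/
  W_compact : IsCompact d.W
  piw_pos : ∀ i, 0 < d.piw i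
  /-- the initial parameter set is bounded -/
  Theta_bounded : Bornology.IsBounded (d.Theta d.mu0)
  /-- state and control constraints -/
  Z_compact : IsCompact d.Z
  Z_interior : (0 : (Fin nx → ℝ) × (Fin nu → ℝ)) ∈ interior d.Z
  /-- `{x | T x ≤ 1}` is a polytope, `lam`-contractive for some `lam ∈ [0,1)`, and without
  redundant inequalities -/
  X_bounded : Bornology.IsBounded (d.X 1)
  contractive : ∃ lam : ℝ, 0 ≤ lam ∧ lam < 1 ∧
    ∀ x ∈ d.X 1, ∀ θ ∈ d.Theta d.mu0, ∀ i, (d.T *ᵥ (d.Phi θ *ᵥ x)) i ≤ lam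
  X_minimal : ∀ i, ∃ x : Fin nx → ℝ, x ∉ d.X 1 ∧ ∀ k, k ≠ i → (d.T *ᵥ x) k ≤ 1
  /-- cost weights -/
  Q_pos : d.Q.PosDef
  R_pos : d.R.PosDef
  /-- `[T]ᵢ U_j = [I]ᵢ` for the `nx` indices `i` in the active set of vertex `j` -/
  Ract_card : ∀ j, (d.Ract j).card = nx
  U_active : ∀ j, ∀ i ∈ d.Ract j, (d.T * d.U j) i = (1 : Matrix (Fin na) (Fin na) ℝ) i
  /-- vertex form of the cross-sections: `{x | T x ≤ α} = Co {U_j α}` for every `α` all of whose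
  inequalities are attained in the cross-section -/
  vertex_form : ∀ α : Fin na → ℝ, (∀ i, ∃ x ∈ d.X α, (d.T *ᵥ x) i = α i) →
    d.X α = convexHull ℝ (Set.range fun j => d.U j *ᵥ α)

end Design

/-! ## The optimization problem -/

/-- Reference state and control sequences. -/
structure Reference (nx nu : ℕ) where
  xhat : ℕ → Fin nx → ℝ
  uhat : ℕ → Fin nu → ℝ

/-- Decision variables. All sequences are indexed by `k : ℕ`; beyond the horizon, `v` and `α` are
fixed below by the dual mode convention `v k = 0`, `α k = α N`, and the predictions follow from it. -/
structure Decision (nx nu p r na m : ℕ) where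
  v : ℕ → Fin nu → ℝ
  α : ℕ → Fin na → ℝ
  xbar : ℕ → Fin nx → ℝ
  ubar : ℕ → Fin nu → ℝ
  β : ℝ
  Λ : ℕ → Fin m → Matrix (Fin na) (Fin r) ℝ
  M : ℕ → Matrix (Fin p) (Fin p) ℝ

namespace Design

variable (d : Design nx nu p nc nw r na m)

/-- The constraints of the MPC problem for the parameter set `Θ(μ)`, the nominal parameter `θbar`,
the reference `ρ` and the current state `x`. -/
structure Feasible (μ : Fin r → ℝ) (θbar : Fin p → ℝ) (ρ : Reference nx nu) (x : Fin nx → ℝ)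
    (s : Decision nx nu p r na m) : Prop where
  /-- dual mode convention beyond the horizon -/
  v_tail : ∀ k, d.N ≤ k → s.v k = 0
  α_tail : ∀ k, d.N ≤ k → s.α k = s.α d.N
  /-- initial condition `T x ≤ α₀` -/
  initial : d.T *ᵥ x ≤ s.α 0
  /-- state and input constraints at the vertices -/
  input_state : ∀ k < d.N, ∀ j,
    ((d.F + d.G * d.K) * d.U j) *ᵥ s.α k + d.G *ᵥ s.v k ≤ 1
  /-- tube inclusions -/
  update_eq : ∀ k < d.N, ∀ j,
    s.Λ k j * d.MΘ = d.T * d.regD (d.U j *ᵥ s.α k) (d.K *ᵥ (d.U j *ᵥ s.α k) + s.v k)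
  update_le : ∀ k < d.N, ∀ j,
    s.Λ k j *ᵥ μ ≤ s.α (k + 1)
      - d.T *ᵥ d.regd (d.U j *ᵥ s.α k) (d.K *ᵥ (d.U j *ᵥ s.α k) + s.v k) - d.wbar
  update_nonneg : ∀ k < d.N, ∀ j i l, 0 ≤ s.Λ k j i l
  /-- terminal conditions -/
  final_con : ∀ j, ((d.F + d.G * d.K) * d.U j) *ᵥ s.α d.N ≤ 1
  final_eq : ∀ j,
    s.Λ d.N j * d.MΘ = d.T * d.regD (d.U j *ᵥ s.α d.N) (d.K *ᵥ (d.U j *ᵥ s.α d.N))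
  final_le : ∀ j,
    s.Λ d.N j *ᵥ μ ≤ s.α d.N
      - d.T *ᵥ d.regd (d.U j *ᵥ s.α d.N) (d.K *ᵥ (d.U j *ᵥ s.α d.N)) - d.wbar
  final_nonneg : ∀ j i l, 0 ≤ s.Λ d.N j i l
  /-- nominal predictions -/
  nominal_zero : s.xbar 0 = x
  nominal_step : ∀ k, s.xbar (k + 1) = d.Phi θbar *ᵥ s.xbar k + d.Bθ θbar *ᵥ s.v k
  nominal_input : ∀ k, s.ubar k = d.K *ᵥ s.xbar k + s.v k
  /-- convexified persistency of excitation constraint with level `β` -/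
  pe_vertex : ∀ k < d.Nu, ∀ j,
    ((d.regD (ρ.xhat k) (ρ.uhat k))ᵀ * d.regD (ρ.xhat k) (ρ.uhat k)
      + (d.regD (d.U j *ᵥ s.α k - ρ.xhat k)
          (d.K *ᵥ (d.U j *ᵥ s.α k) + s.v k - ρ.uhat k))ᵀ * d.regD (ρ.xhat k) (ρ.uhat k)
      + (d.regD (ρ.xhat k) (ρ.uhat k))ᵀ * d.regD (d.U j *ᵥ s.α k - ρ.xhat k)
          (d.K *ᵥ (d.U j *ᵥ s.α k) + s.v k - ρ.uhat k)
      - s.M k).PosSemidef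
  pe_sum : (∑ k ∈ Finset.range d.Nu, s.M k - s.β • (1 : Matrix (Fin p) (Fin p) ℝ)).PosSemidef

/-- The objective, with weight `γ` on the excitation level. -/
def cost (γ : ℝ) (θbar : Fin p → ℝ) (s : Decision nx nu p r na m) : ℝ :=
  ∑ k ∈ Finset.range d.N, (wsq d.Q (s.xbar k) + wsq d.R (s.ubar k))
    + wsq (d.lyapP θbar) (s.xbar d.N) - γ * s.β

/-- `s` is an optimal solution of the MPC problem. -/
def IsOptimal (γ : ℝ) (μ : Fin r → ℝ) (θbar : Fin p → ℝ) (ρ : Reference nx nu)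
    (x : Fin nx → ℝ) (s : Decision nx nu p r na m) : Prop :=
  d.Feasible μ θbar ρ x s ∧ ∀ s', d.Feasible μ θbar ρ x s' → d.cost γ θbar s ≤ d.cost γ θbar s'

/-- The MPC problem is feasible. -/
def IsFeasible (μ : Fin r → ℝ) (θbar : Fin p → ℝ) (ρ : Reference nx nu) (x : Fin nx → ℝ) : Prop :=
  ∃ s, d.Feasible μ θbar ρ x s

/-- The set `X_P` of initial states for which the MPC problem is feasible; `ref0` is the rule
providing the reference sequences at time `0`. -/
def feasibleSet (θbar0 : Fin p → ℝ) (ref0 : (Fin nx → ℝ) → Reference nx nu) :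
    Set (Fin nx → ℝ) :=
  {x | d.IsFeasible d.mu0 θbar0 (ref0 x) x}

/-! ## The closed loop -/

/-- The unfalsified parameter set `Δ` for a transition from `x` to `x'` under the input `u`. -/
def unfalsified (x' x : Fin nx → ℝ) (u : Fin nu → ℝ) : Set (Fin p → ℝ) :=
  {θ | x' - d.Aθ θ *ᵥ x - d.Bθ θ *ᵥ u ∈ d.W}

end Design

/-- The signals of the closed loop. -/
structure Signals (nx nu p r na m : ℕ) where
  x : ℕ → Fin nx → ℝ
  u : ℕ → Fin nu → ℝ
  mu : ℕ → Fin r → ℝ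
  ref : ℕ → Reference nx nu
  sol : ℕ → Decision nx nu p r na m

/-- The closed loop of the uncertain system with true parameter `θstar`, disturbance `w`, nominal
parameters `θbar t`, and the MPC algorithm with weight `γ` and initial reference rule `ref0`. -/
structure IsClosedLoop (d : Design nx nu p nc nw r na m) (γ : ℝ) (θbar : ℕ → Fin p → ℝ)
    (ref0 : (Fin nx → ℝ) → Reference nx nu) (θstar : Fin p → ℝ) (w : ℕ → Fin nx → ℝ)
    (L : Signals nx nu p r na m) : Prop where
  /-- system -/
  system : ∀ t, L.x (t + 1) = d.Aθ θstar *ᵥ L.x t + d.Bθ θstar *ᵥ L.u t + w t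
  /-- parameter set: `Θ_{t+1} = Θ(μ_{t+1})` is the smallest set of this form that contains the
  intersection of `Θ_t` with the sets `Δ_j`, `t + 1 - Nu + 1 ≤ j ≤ t + 1`, where only those with
  `j = i + 1 ≥ 1` restrict anything -/
  mu_zero : L.mu 0 = d.mu0
  mu_step : ∀ t, IsLeast {μ : Fin r → ℝ |
      {θ ∈ d.Theta (L.mu t) | ∀ i ≤ t, t < i + d.Nu →
        θ ∈ d.unfalsified (L.x (i + 1)) (L.x i) (L.u i)} ⊆ d.Theta μ} (L.mu (t + 1))
  /-- references: given by `ref0` initially, then the shifted previous solution -/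
  ref_zero : L.ref 0 = ref0 (L.x 0)
  xhat_zero : ∀ t, (L.ref (t + 1)).xhat 0 = L.x (t + 1)
  xhat_step : ∀ t k, (L.ref (t + 1)).xhat (k + 1)
      = d.Aθ (θbar (t + 1)) *ᵥ (L.ref (t + 1)).xhat k
        + d.Bθ (θbar (t + 1)) *ᵥ (L.ref (t + 1)).uhat k
  uhat_eq : ∀ t k, (L.ref (t + 1)).uhat k = d.K *ᵥ (L.ref (t + 1)).xhat k
      + (if k + 1 < d.N then (L.sol t).v (k + 1) else 0)
  /-- optimization and control law `u_t = K x_t + v*_{0|t}` -/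
  optimal : ∀ t, d.IsOptimal γ (L.mu t) (θbar t) (L.ref t) (L.x t) (L.sol t)
  control : ∀ t, L.u t = d.K *ᵥ L.x t + (L.sol t).v 0

/-- The input-to-state estimate along a trajectory. The maxima over `k < t` are `0` for `t = 0`. -/
def ISSBound (η : ℝ≥0 → ℝ≥0 → ℝ≥0) (ψ ζ : ℝ≥0 → ℝ≥0) (x w : ℕ → Fin nx → ℝ)
    (θbar : ℕ → Fin p → ℝ) (θstar : Fin p → ℝ) : Prop :=
  ∀ t : ℕ, euclNorm (x t) ≤ η (euclNorm (x 0)) t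
    + ψ ((Finset.range t).sup fun k => euclNorm (w k))
    + ζ ((Finset.range t).sup fun k => euclNorm (θbar k - θstar))

end AdaptiveMPC

end

namespace AdaptiveMPC

/-! ## Quadratic forms and matrices in the supremum norm -/

/-! With `γ = 0` the excitation constraint is vacuous: `β` is free, so `M k` may be a very negative
multiple of the identity. A feasible decision is then a tube (`IsTube`), consisting of perturbations
`v`, cross-sections `α` and certificates `Λ`, and the objective is a function `J` of `v` alone that
no longer involves the reference.

Recursive feasibility. The certificates are linear programming duals: `Λ ≥ 0` and `Λ MΘ = T D` give
`T D θ ≤ Λ μ` on all of `Θ(μ)`. So the vertex conditions imply the true inclusion for every `θ ∈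
Θ(μ)`, provided the points `U j α` span at least the cross-section; `X_subset_convexHull` proves
this for arbitrary `α`, although the vertex form is assumed only for tight ones. The true parameter
is never falsified and `μ` only decreases, so the shifted tube is feasible at the next state
(`IsTube.next`).

Optimal solutions. The admissible `v` are bounded because `Z` is, and form a closed set because
projections of polyhedra are closed (`isClosed_exists_linear_le`). This avoids any bound on `α` and
`Λ`.

Stability. The optimal cost is an ISS Lyapunov function between two multiples of `‖x‖²`. The lower
bound is the first stage cost. For the upper bound, the terminal section of any feasible tube
contains `W`, a neighbourhood of `0`: near the origin `v = 0` is feasible with quadratic cost, and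
elsewhere a uniform bound suffices (`exists_quadratic_bound`). Shifting saves the stage cost exactly
(`J_shift`), since the terminal weight solves the Lyapunov equation. The true successor differs from
the nominal one by `e = D(x,u)(θ* - θbar) + w`, which costs a small multiple of `J` plus a multiple
of `‖e‖²` (`J_add_le`). The resulting contraction gives exponential ISS in `exists_iss_constants`.
All constants are uniform in the nominal parameter, the true parameter and the reference rule. -/

lemma exists_norm_mulVec_le {m n : ℕ} (S : Matrix (Fin m) (Fin n) ℝ) :
    ∃ C : ℝ, 0 ≤ C ∧ ∀ x, ‖S *ᵥ x‖ ≤ C * ‖x‖ :=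
  ⟨‖LinearMap.toContinuousLinearMap S.mulVecLin‖, norm_nonneg _,
    fun x => (LinearMap.toContinuousLinearMap S.mulVecLin).le_opNorm x⟩

lemma abs_dotProduct_le {n : ℕ} (x y : Fin n → ℝ) : |x ⬝ᵥ y| ≤ n * (‖x‖ * ‖y‖) := by
  calc |x ⬝ᵥ y| ≤ ∑ i, |x i * y i| := Finset.abs_sum_le_sum_abs _ _
    _ ≤ ∑ _i : Fin n, ‖x‖ * ‖y‖ := by
        refine Finset.sum_le_sum fun i _ => ?_
        rw [abs_mul]
        exact mul_le_mul (norm_le_pi_norm x i) (norm_le_pi_norm y i) (abs_nonneg _) (norm_nonneg _)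
    _ = n * (‖x‖ * ‖y‖) := by simp

lemma exists_abs_wsq_le {n : ℕ} (S : Matrix (Fin n) (Fin n) ℝ) :
    ∃ C : ℝ, 0 ≤ C ∧ ∀ x, |wsq S x| ≤ C * ‖x‖ ^ 2 := by
  obtain ⟨C, hC, h⟩ := exists_norm_mulVec_le S
  refine ⟨n * C, by positivity, fun x => ?_⟩
  calc |wsq S x| ≤ n * (‖x‖ * ‖S *ᵥ x‖) := abs_dotProduct_le _ _
    _ ≤ n * (‖x‖ * (C * ‖x‖)) := by gcongr; exact h x
    _ = n * C * ‖x‖ ^ 2 := by ring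

lemma wsq_smul {n : ℕ} (S : Matrix (Fin n) (Fin n) ℝ) (c : ℝ) (x : Fin n → ℝ) :
    wsq S (c • x) = c ^ 2 * wsq S x := by
  simp only [wsq, Matrix.mulVec_smul, smul_dotProduct, dotProduct_smul, smul_eq_mul]; ring

lemma wsq_zero {n : ℕ} (S : Matrix (Fin n) (Fin n) ℝ) : wsq S 0 = 0 := by simp [wsq]

lemma wsq_add {n : ℕ} (S : Matrix (Fin n) (Fin n) ℝ) (x y : Fin n → ℝ) :
    wsq S (x + y) = wsq S x + (x ⬝ᵥ (S *ᵥ y) + y ⬝ᵥ (S *ᵥ x)) + wsq S y := by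
  simp only [wsq, Matrix.mulVec_add, add_dotProduct, dotProduct_add]; ring

lemma continuous_wsq {n : ℕ} (S : Matrix (Fin n) (Fin n) ℝ) : Continuous (wsq S) := by
  unfold wsq; fun_prop

lemma wsq_pos {n : ℕ} {S : Matrix (Fin n) (Fin n) ℝ} (hS : S.PosDef) {x : Fin n → ℝ}
    (hx : x ≠ 0) : 0 < wsq S x := by
  simpa [wsq] using hS.dotProduct_mulVec_pos hx

lemma wsq_nonneg {n : ℕ} {S : Matrix (Fin n) (Fin n) ℝ} (hS : S.PosDef) (x : Fin n → ℝ) :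
    0 ≤ wsq S x := by
  simpa [wsq] using hS.posSemidef.dotProduct_mulVec_nonneg x

lemma exists_le_wsq {n : ℕ} {S : Matrix (Fin n) (Fin n) ℝ} (hS : S.PosDef) :
    ∃ c : ℝ, 0 < c ∧ ∀ x, c * ‖x‖ ^ 2 ≤ wsq S x := by
  by_cases hne : (Metric.sphere (0 : Fin n → ℝ) 1).Nonempty
  · obtain ⟨z, hz, hmin⟩ := (isCompact_sphere (0 : Fin n → ℝ) 1).exists_isMinOn hne
      (continuous_wsq S).continuousOn
    have hz1 : ‖z‖ = 1 := by simpa using hz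
    refine ⟨wsq S z, wsq_pos hS (by rintro rfl; simp at hz1), fun x => ?_⟩
    rcases eq_or_ne x 0 with rfl | hx
    · simp [wsq_zero]
    have hx' : 0 < ‖x‖ := norm_pos_iff.2 hx
    have hu : ‖x‖⁻¹ • x ∈ Metric.sphere (0 : Fin n → ℝ) 1 := by
      simp [norm_smul, hx'.ne']
    have h1 := hmin hu
    simp only [Set.mem_ofPred_eq, wsq_smul] at h1
    calc wsq S z * ‖x‖ ^ 2 ≤ (‖x‖⁻¹ ^ 2 * wsq S x) * ‖x‖ ^ 2 := by gcongr
      _ = wsq S x := by field_simp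
  · refine ⟨1, one_pos, fun x => ?_⟩
    have hx : x = 0 := by
      by_contra hx
      have hx' : 0 < ‖x‖ := norm_pos_iff.2 hx
      exact hne ⟨‖x‖⁻¹ • x, by simp [norm_smul, hx'.ne']⟩
    subst hx; simp [wsq_zero]

/-- Young's inequality, read off from nonnegativity of the form at `δ a - b`. The two cross terms
stay separate, so `S` need not be symmetric. -/
lemma wsq_add_le {n : ℕ} {S : Matrix (Fin n) (Fin n) ℝ} (hS : ∀ x, 0 ≤ wsq S x)
    {δ : ℝ} (hδ : 0 < δ) (a b : Fin n → ℝ) :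
    wsq S (a + b) ≤ (1 + δ) * wsq S a + (1 + δ⁻¹) * wsq S b := by
  have h := hS (δ • a + (-1 : ℝ) • b)
  rw [wsq_add, wsq_smul, wsq_smul] at h
  simp only [Matrix.mulVec_smul, smul_dotProduct, dotProduct_smul, smul_eq_mul] at h
  rw [wsq_add]
  have h2 : 0 ≤ δ⁻¹ * (δ ^ 2 * wsq S a + (-1 * (δ * a ⬝ᵥ S *ᵥ b) + δ * (-1 * b ⬝ᵥ S *ᵥ a))
      + (-1) ^ 2 * wsq S b) := mul_nonneg (by positivity) (by linarith)
  have h3 : δ⁻¹ * (δ ^ 2 * wsq S a + (-1 * (δ * a ⬝ᵥ S *ᵥ b) + δ * (-1 * b ⬝ᵥ S *ᵥ a))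
      + (-1) ^ 2 * wsq S b) = δ * wsq S a - (a ⬝ᵥ S *ᵥ b + b ⬝ᵥ S *ᵥ a) + δ⁻¹ * wsq S b := by
    field_simp; ring
  linarith

/-- Holding for every larger `c'` allows one constant to serve all tube vertices at once. -/
lemma exists_add_smul_one_posSemidef {n : ℕ} {H : Matrix (Fin n) (Fin n) ℝ} (hH : H.IsHermitian) :
    ∃ c : ℝ, ∀ c', c ≤ c' → (H + c' • (1 : Matrix (Fin n) (Fin n) ℝ)).PosSemidef := by
  obtain ⟨C, hC, h⟩ := exists_abs_wsq_le H
  refine ⟨C, fun c' hc' => .of_dotProduct_mulVec_nonneg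
    (hH.add (by simp [Matrix.IsHermitian])) fun x => ?_⟩
  have h1 : ‖x‖ ^ 2 ≤ x ⬝ᵥ x := by
    have hx : 0 ≤ x ⬝ᵥ x := Finset.sum_nonneg fun i _ => mul_self_nonneg _
    have h2 : ‖x‖ ≤ √(x ⬝ᵥ x) := by
      refine (pi_norm_le_iff_of_nonneg (Real.sqrt_nonneg _)).2 fun i => Real.le_sqrt_of_sq_le ?_
      rw [Real.norm_eq_abs, sq_abs, sq]
      exact Finset.single_le_sum (f := fun i => x i * x i) (fun i _ => mul_self_nonneg _)
        (Finset.mem_univ i)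
    calc ‖x‖ ^ 2 ≤ √(x ⬝ᵥ x) ^ 2 := by gcongr
      _ = x ⬝ᵥ x := Real.sq_sqrt hx
  have h2 := neg_le_of_abs_le (h x)
  have h3 : star x ⬝ᵥ ((H + c' • (1 : Matrix (Fin n) (Fin n) ℝ)) *ᵥ x)
      = wsq H x + c' * (x ⬝ᵥ x) := by
    simp [wsq, Matrix.add_mulVec, Matrix.smul_mulVec, dotProduct_add]
  rw [h3]
  have h4 : C * ‖x‖ ^ 2 ≤ c' * (x ⬝ᵥ x) := mul_le_mul hc' h1 (by positivity) (hC.trans hc')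
  linarith

/-! ## Projections of polyhedra are closed -/

/-- Induction on the set of constraints, discarding those that can be satisfied for free along a
recession direction. `E` may be infinite-dimensional, as compactness is used only in the
finite-dimensional range. -/
lemma isClosed_exists_linear_le {E ι : Type*} [AddCommGroup E] [Module ℝ E] [Fintype ι]
    (B : ι → E →ₗ[ℝ] ℝ) : IsClosed {c : ι → ℝ | ∃ y, ∀ i, B i y ≤ c i} := by
  classical
  suffices H : ∀ s : Finset ι, IsClosed {c : ι → ℝ | ∃ y, ∀ i ∈ s, B i y ≤ c i} by
    simpa using H Finset.univ
  intro s
  induction s using Finset.strongInduction with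
  | H s ih =>
  by_cases hy : ∃ y, (∀ i ∈ s, B i y ≤ 0) ∧ ∃ i ∈ s, B i y < 0
  -- Moving far along `y` meets every constraint with `B i y < 0` without harming the rest, so only
  -- those with `B i y = 0` matter.
  · obtain ⟨y, hy, i₀, hi₀, hlt⟩ := hy
    have hss : s.filter (fun i => B i y = 0) ⊂ s :=
      Finset.filter_ssubset.2 ⟨i₀, hi₀, hlt.ne⟩
    convert ih _ hss using 1
    ext c
    constructor
    · rintro ⟨z, hz⟩
      exact ⟨z, fun i hi => hz i (Finset.mem_filter.1 hi).1⟩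
    · rintro ⟨z, hz⟩
      obtain ⟨M, hM⟩ := (s.image fun i => (c i - B i z) / B i y).exists_le
      refine ⟨z + M • y, fun i hi => ?_⟩
      rw [map_add, map_smul, smul_eq_mul]
      rcases (hy i hi).lt_or_eq with h | h
      · have := hM _ (Finset.mem_image_of_mem _ hi)
        rw [div_le_iff_of_neg h] at this
        linarith
      · have := hz i (Finset.mem_filter.2 ⟨hi, h⟩)
        rw [h]; linarith
  -- Now every recession direction lies in the kernel of `L`. Hence `L (y n)` is bounded, since a
  -- normalised limit would be a nonzero recession direction in the range, and a subsequence
  -- converges inside the closed range.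
  · push Not at hy
    have hz : ∀ y, (∀ i ∈ s, B i y ≤ 0) → ∀ i ∈ s, B i y = 0 := fun y h i hi =>
      le_antisymm (h i hi) (hy y h i hi)
    let L : E →ₗ[ℝ] (s → ℝ) := LinearMap.pi fun i => B i
    have hL : IsClosed (LinearMap.range L : Set (s → ℝ)) := Submodule.closed_of_finiteDimensional _
    refine IsSeqClosed.isClosed ?_
    intro c c₀ hc hlim
    choose y hy using hc
    have hbdd : ∃ C, ∀ n, ‖L (y n)‖ ≤ C := by
      by_contra! hcon
      choose k hk using fun n : ℕ => hcon (n + 1)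
      obtain ⟨D, hD⟩ := hlim.norm.bddAbove_range
      have hD' : ∀ n, ‖c n‖ ≤ D := fun n => hD ⟨n, rfl⟩
      have hpos : ∀ n, 0 < ‖L (y (k n))‖ := fun n => by
        have := hk n; have : (0 : ℝ) ≤ n := n.cast_nonneg; linarith
      set z : ℕ → s → ℝ := fun n => ‖L (y (k n))‖⁻¹ • L (y (k n))
      have hzmem : ∀ n, z n ∈ (LinearMap.range L : Set (s → ℝ)) ∩ Metric.sphere 0 1 := fun n =>
        ⟨Submodule.smul_mem _ _ ⟨_, rfl⟩, by simp [z, norm_smul, (hpos n).ne']⟩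
      obtain ⟨a, ha, φ, hφ, hφlim⟩ := ((isCompact_sphere (0 : s → ℝ) 1).inter_left hL).tendsto_subseq
        hzmem
      obtain ⟨⟨e, rfl⟩, ha1⟩ := ha
      have hle : ∀ i ∈ s, B i e ≤ 0 := by
        intro i hi
        have h1 : Tendsto (fun n => z (φ n) ⟨i, hi⟩) atTop (𝓝 (L e ⟨i, hi⟩)) :=
          (tendsto_pi_nhds.1 hφlim) ⟨i, hi⟩
        have h2 : Tendsto (fun n : ℕ => D / (((φ n : ℕ) : ℝ) + 1)) atTop (𝓝 0) :=
          (tendsto_const_div_atTop_nhds_zero_nat D).comp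
            ((tendsto_add_atTop_nat 1).comp hφ.tendsto_atTop) |>.congr fun n => by simp
        refine le_of_tendsto_of_tendsto' h1 h2 fun n => ?_
        have h3 : B i (y (k (φ n))) ≤ D :=
          (hy _ i hi).trans ((le_abs_self _).trans ((norm_le_pi_norm (c _) i).trans (hD' _)))
        have hD0 : 0 ≤ D := (norm_nonneg _).trans (hD' 0)
        have h4 : z (φ n) ⟨i, hi⟩ = ‖L (y (k (φ n)))‖⁻¹ * B i (y (k (φ n))) := rfl
        rw [h4]
        calc ‖L (y (k (φ n)))‖⁻¹ * B i (y (k (φ n))) ≤ ‖L (y (k (φ n)))‖⁻¹ * D := by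
              have := hpos (φ n); gcongr
          _ ≤ (((φ n : ℕ) : ℝ) + 1)⁻¹ * D := by
              have := hk (φ n); gcongr
          _ = _ := by rw [div_eq_inv_mul]
      have h0 : L e = 0 := by
        ext i; exact hz e hle i i.2
      rw [h0] at ha1; simp at ha1
    obtain ⟨C, hC⟩ := hbdd
    obtain ⟨a, ha, φ, hφ, hφlim⟩ :=
      ((isCompact_closedBall (0 : s → ℝ) C).inter_left hL).tendsto_subseq (x := fun n => L (y n))
        fun n => ⟨⟨_, rfl⟩, by simpa using hC n⟩
    obtain ⟨⟨e, rfl⟩, -⟩ := ha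
    refine ⟨e, fun i hi => ?_⟩
    exact le_of_tendsto_of_tendsto' ((tendsto_pi_nhds.1 hφlim) ⟨i, hi⟩)
      ((tendsto_pi_nhds.1 (hlim.comp hφ.tendsto_atTop)) i) fun n => hy _ i hi

/-- A finite system of inequalities `B y ≤ g v`, linear in `y` and continuous in `v`. -/
def IsLinearSystem {V E : Type*} [TopologicalSpace V] [AddCommGroup E] [Module ℝ E]
    (C : V → E → Prop) : Prop :=
  ∃ (n : ℕ) (B : Fin n → E →ₗ[ℝ] ℝ) (g : Fin n → V → ℝ), (∀ i, Continuous (g i)) ∧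
    ∀ v y, C v y ↔ ∀ i, B i y ≤ g i v

namespace IsLinearSystem

variable {V E : Type*} [TopologicalSpace V] [AddCommGroup E] [Module ℝ E]

lemma isClosed {C : V → E → Prop} (h : IsLinearSystem C) : IsClosed {v | ∃ y, C v y} := by
  obtain ⟨n, B, g, hg, h⟩ := h
  simp only [h]
  exact (isClosed_exists_linear_le B).preimage (f := fun v i => g i v) (continuous_pi hg)

lemma of_fintype {C : V → E → Prop} {ι : Type*} [Finite ι] (B : ι → E →ₗ[ℝ] ℝ) (g : ι → V → ℝ)
    (hg : ∀ i, Continuous (g i)) (h : ∀ v y, C v y ↔ ∀ i, B i y ≤ g i v) : IsLinearSystem C := by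
  obtain ⟨n, ⟨e⟩⟩ := Finite.exists_equiv_fin ι
  refine ⟨n, fun i => B (e.symm i), fun i => g (e.symm i), fun i => hg _, fun v y => ?_⟩
  rw [h, e.symm.forall_congr_left]
  simp

lemma single {C : V → E → Prop} (B : E →ₗ[ℝ] ℝ) {g : V → ℝ} (hg : Continuous g)
    (h : ∀ v y, C v y ↔ B y ≤ g v) : IsLinearSystem C :=
  of_fintype (fun _ : Unit => B) (fun _ => g) (fun _ => hg) fun v y => by simp [h]

lemma forall_finite {ι : Type*} [Finite ι] {C : ι → V → E → Prop} (h : ∀ i, IsLinearSystem (C i)) :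
    IsLinearSystem fun v y => ∀ i, C i v y := by
  choose n B g hg h using h
  exact of_fintype (ι := Σ i, Fin (n i)) (fun i => B i.1 i.2) (fun i => g i.1 i.2)
    (fun i => hg _ _) fun v y => by simp [h, Sigma.forall]

lemma and {C C' : V → E → Prop} (h : IsLinearSystem C) (h' : IsLinearSystem C') :
    IsLinearSystem fun v y => C v y ∧ C' v y := by
  have := forall_finite (ι := Bool) (C := fun b => if b then C else C') fun b => by
    cases b <;> simpa
  simpa [and_comm] using this

lemma eq {C : V → E → Prop} (B : E →ₗ[ℝ] ℝ) {g : V → ℝ} (hg : Continuous g)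
    (h : ∀ v y, C v y ↔ B y = g v) : IsLinearSystem C := by
  have := (single B hg fun _ _ => Iff.rfl).and (single (-B) hg.neg fun _ _ => Iff.rfl)
  convert this using 3 with v y
  rw [h]
  constructor
  · intro h; simp [h]
  · rintro ⟨h1, h2⟩
    exact le_antisymm h1 (by simpa using h2)

end IsLinearSystem

variable {nx nu p nc nw r na m : ℕ}

lemma mulVec_le_mulVec_of_nonneg {k l : ℕ} {M : Matrix (Fin k) (Fin l) ℝ} (hM : ∀ i j, 0 ≤ M i j)
    {a b : Fin l → ℝ} (hab : a ≤ b) : M *ᵥ a ≤ M *ᵥ b :=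
  fun i => by
    simp only [Matrix.mulVec, dotProduct]
    exact Finset.sum_le_sum fun j _ => mul_le_mul_of_nonneg_left (hab j) (hM i j)

namespace Design

variable {d : Design nx nu p nc nw r na m}

/-! ## Geometry of the tube cross-sections -/

/-- Irredundancy supplies for each `i` a point violating only inequality `i`. Scaled back until that
inequality is tight, it satisfies the others with slack, which survives a small change of the
right-hand side. -/
lemma exists_tight_near_one (hd : d.Standing) : ∃ δ : ℝ, 0 < δ ∧ ∀ α : Fin na → ℝ,
    (∀ i, |α i - 1| ≤ δ) → ∀ i, ∃ x ∈ d.X α, (d.T *ᵥ x) i = α i := by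
  choose x hx hx' using hd.X_minimal
  have hgt : ∀ i, 1 < (d.T *ᵥ x i) i := by
    intro i
    by_contra! h
    refine hx i fun k => ?_
    by_cases hk : k = i
    · subst hk; exact h
    · exact hx' i k hk
  have hs : ∃ s : ℝ, 0 ≤ s ∧ s < 1 ∧ ∀ i, ((d.T *ᵥ x i) i)⁻¹ ≤ s := by
    by_cases hna : Nonempty (Fin na)
    · obtain ⟨i, hi⟩ := Finite.exists_max fun i => ((d.T *ᵥ x i) i)⁻¹
      exact ⟨_, inv_nonneg.2 (by linarith [hgt i]), inv_lt_one_of_one_lt₀ (hgt i), hi⟩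
    · exact ⟨0, le_rfl, one_pos, fun i => (hna ⟨i⟩).elim⟩
  obtain ⟨s, hs0, hs1, hs⟩ := hs
  -- Chosen so that `(1 + δ) s ≤ 1 - δ`.
  refine ⟨(1 - s) / 2, by linarith, fun α hα i => ?_⟩
  have hαi := abs_le.1 (hα i)
  have hpos := hgt i
  refine ⟨(α i * ((d.T *ᵥ x i) i)⁻¹) • x i, fun k => ?_, ?_⟩
  · rw [Matrix.mulVec_smul, Pi.smul_apply, smul_eq_mul]
    by_cases hk : k = i
    · subst hk
      rw [mul_assoc, inv_mul_cancel₀ (by linarith), mul_one]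
    have hαk := abs_le.1 (hα k)
    have h0 : 0 ≤ α i := by linarith
    calc α i * ((d.T *ᵥ x i) i)⁻¹ * (d.T *ᵥ x i) k ≤ α i * ((d.T *ᵥ x i) i)⁻¹ * 1 :=
          mul_le_mul_of_nonneg_left (hx' i k hk)
            (mul_nonneg h0 (inv_nonneg.2 (by linarith)))
      _ ≤ α i * s * 1 := by gcongr; exact hs i
      _ ≤ α k := by nlinarith
  · rw [Matrix.mulVec_smul, Pi.smul_apply, smul_eq_mul, mul_assoc, inv_mul_cancel₀ (by linarith),
      mul_one]

lemma nonempty_vertices (hd : d.Standing) : Nonempty (Fin m) := by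
  obtain ⟨δ, hδ, h⟩ := exists_tight_near_one hd
  have h1 := hd.vertex_form 1 (h 1 fun _ => by simpa using hδ.le)
  have h0 : (0 : Fin nx → ℝ) ∈ d.X 1 := by
    simp only [X, Set.mem_ofPred_eq, Matrix.mulVec_zero]
    exact zero_le_one
  rw [h1] at h0
  exact Set.range_nonempty_iff_nonempty.1 (convexHull_nonempty_iff.1 ⟨_, h0⟩)

/-- For an arbitrary `α`, the points `U_j α` span at least the cross-section. -/
theorem X_subset_convexHull (hd : d.Standing) (β : Fin na → ℝ) :
    d.X β ⊆ convexHull ℝ (Set.range fun j => d.U j *ᵥ β) := by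
  intro x hx
  by_contra hcon
  have hm := nonempty_vertices hd
  obtain ⟨δ, hδ, htight⟩ := exists_tight_near_one hd
  obtain ⟨f, u, hf1, hf2⟩ := geometric_hahn_banach_closed_point (convex_convexHull ℝ _)
    ((Set.finite_range fun j => d.U j *ᵥ β).isClosed_convexHull ℝ) hcon
  have hε : ∃ ε : ℝ, 0 < ε ∧ ∀ i, ε * |β i - 1| ≤ δ := by
    refine ⟨δ / (‖β - 1‖ + 1), by positivity, fun i => ?_⟩
    have := norm_le_pi_norm (β - 1) i
    simp only [Pi.sub_apply, Pi.one_apply, Real.norm_eq_abs] at this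
    rw [div_mul_eq_mul_div, div_le_iff₀ (by positivity)]
    gcongr; linarith
  obtain ⟨ε, hε, hεδ⟩ := hε
  -- `1` becomes a convex combination of `β` and a tight `α` on its far side. Cross-sections are
  -- superadditive in the right-hand side, while `U j` is linear; comparing maxima of `f` at `1` and
  -- `α`, where the vertex form is available, bounds `f x` by the value at a vertex for `β`.
  set α : Fin na → ℝ := 1 - ε • (β - 1) with hα
  have hαt := hd.vertex_form α <| htight α fun i => by
    simpa [hα, abs_mul, abs_of_pos hε] using hεδ i
  have h1 := hd.vertex_form 1 (htight 1 fun _ => by simpa using hδ.le)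
  obtain ⟨j', hj'⟩ := Finite.exists_max fun j => f (d.U j *ᵥ α)
  obtain ⟨j₀, hj₀⟩ := Finite.exists_max fun j => f (d.U j *ᵥ (1 : Fin na → ℝ))
  have hmem : d.U j' *ᵥ α ∈ d.X α := by
    rw [hαt]; exact subset_convexHull ℝ _ ⟨j', rfl⟩
  have hz : (1 + ε)⁻¹ • (ε • x + d.U j' *ᵥ α) ∈ d.X 1 := by
    intro i
    have hxi := hx i
    have hyi := hmem i
    rw [Matrix.mulVec_smul, Matrix.mulVec_add, Matrix.mulVec_smul]
    simp only [Pi.smul_apply, Pi.add_apply, smul_eq_mul, Pi.one_apply]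
    rw [inv_mul_le_iff₀ (by positivity)]
    have : α i = 1 - ε * (β i - 1) := by simp [hα]
    nlinarith [mul_le_mul_of_nonneg_left hxi hε.le]
  have hfz : f ((1 + ε)⁻¹ • (ε • x + d.U j' *ᵥ α)) ≤ f (d.U j₀ *ᵥ (1 : Fin na → ℝ)) := by
    rw [h1] at hz
    refine convexHull_min (s := Set.range fun j => d.U j *ᵥ (1 : Fin na → ℝ))
      (t := {z | f z ≤ f (d.U j₀ *ᵥ (1 : Fin na → ℝ))}) ?_ ?_ hz
    · rintro _ ⟨j, rfl⟩; exact hj₀ j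
    · exact convex_halfSpace_le f.toLinearMap.isLinear _
  have hone : (1 : Fin na → ℝ) = (1 + ε)⁻¹ • (ε • β + α) := by
    ext i; simp [hα]; field_simp; ring
  rw [hone, Matrix.mulVec_smul, Matrix.mulVec_add, Matrix.mulVec_smul, map_smul, map_smul, map_add,
    map_add, map_smul, map_smul] at hfz
  simp only [smul_eq_mul] at hfz
  have hfz' := le_of_mul_le_mul_left hfz (by positivity : 0 < (1 + ε)⁻¹)
  have h2 := hj' j₀
  have h3 : f (d.U j₀ *ᵥ β) < u := hf1 _ (subset_convexHull ℝ _ ⟨j₀, rfl⟩)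
  have h4 : ε * f x ≤ ε * f (d.U j₀ *ᵥ β) := by linarith
  have := le_of_mul_le_mul_left h4 hε
  linarith

lemma mulVec_le_of_mem_X (hd : d.Standing) {l : ℕ} (L : Matrix (Fin l) (Fin nx) ℝ)
    {α : Fin na → ℝ} {b : Fin l → ℝ} (h : ∀ j, L *ᵥ (d.U j *ᵥ α) ≤ b) {x : Fin nx → ℝ}
    (hx : x ∈ d.X α) : L *ᵥ x ≤ b := by
  refine convexHull_min (t := {z | L *ᵥ z ≤ b}) ?_ ?_ (X_subset_convexHull hd α hx)
  · rintro _ ⟨j, rfl⟩; exact h j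
  · intro y hy z hz s t hs ht hst i
    have h1 := hy i
    have h2 := hz i
    rw [Matrix.mulVec_add, Matrix.mulVec_smul, Matrix.mulVec_smul]
    simp only [Pi.add_apply, Pi.smul_apply, smul_eq_mul]
    calc s * (L *ᵥ y) i + t * (L *ᵥ z) i ≤ s * b i + t * b i := by gcongr
      _ = b i := by rw [← add_mul, hst, one_mul]

/-! ## The model -/

lemma regD_mulVec_add_regd (θ : Fin p → ℝ) (x : Fin nx → ℝ) (u : Fin nu → ℝ) :
    d.regD x u *ᵥ θ + d.regd x u = d.Aθ θ *ᵥ x + d.Bθ θ *ᵥ u := by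
  have h : d.regD x u *ᵥ θ = ∑ l, θ l • (d.A l *ᵥ x + d.B l *ᵥ u) := by
    ext i
    simp [regD, Matrix.mulVec, dotProduct, mul_comm, mul_add]
  rw [h]
  simp only [regd, Aθ, Bθ, Matrix.add_mulVec, Matrix.sum_mulVec, Matrix.smul_mulVec, smul_add,
    Finset.sum_add_distrib]
  abel

lemma Phi_mulVec (θ : Fin p → ℝ) (x : Fin nx → ℝ) :
    d.Phi θ *ᵥ x = d.Aθ θ *ᵥ x + d.Bθ θ *ᵥ (d.K *ᵥ x) := by
  simp [Phi, Matrix.add_mulVec, Matrix.mulVec_mulVec]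

lemma closedLoop_eq (θ : Fin p → ℝ) (x : Fin nx → ℝ) (v : Fin nu → ℝ) :
    d.Aθ θ *ᵥ x + d.Bθ θ *ᵥ (d.K *ᵥ x + v) = d.Phi θ *ᵥ x + d.Bθ θ *ᵥ v := by
  rw [Phi_mulVec, Matrix.mulVec_add, add_assoc]

lemma mulVec_le_wbar (hd : d.Standing) {w : Fin nx → ℝ} (hw : w ∈ d.W) : d.T *ᵥ w ≤ d.wbar := by
  intro i
  refine le_csSup (hd.W_compact.image ?_).bddAbove ⟨w, hw, rfl⟩
  fun_prop

lemma W_mem_nhds (hd : d.Standing) : d.W ∈ 𝓝 (0 : Fin nx → ℝ) := by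
  have : ∀ᶠ w in 𝓝 (0 : Fin nx → ℝ), ∀ i, (d.PiW *ᵥ w) i < d.piw i := by
    rw [eventually_all]
    intro i
    have hc : Continuous fun w : Fin nx → ℝ => (d.PiW *ᵥ w) i := by fun_prop
    exact hc.continuousAt.eventually_lt_const (by simpa using hd.piw_pos i)
  filter_upwards [this] with w hw i using (hw i).le

lemma zero_mem_W (hd : d.Standing) : (0 : Fin nx → ℝ) ∈ d.W := mem_of_mem_nhds (W_mem_nhds hd)

/-- The tube constraints of the MPC problem, with the terminal conditions as the case `k = N`. -/
structure IsTube (d : Design nx nu p nc nw r na m) (μ : Fin r → ℝ) (x : Fin nx → ℝ)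
    (v : ℕ → Fin nu → ℝ) (α : ℕ → Fin na → ℝ) (Λ : ℕ → Fin m → Matrix (Fin na) (Fin r) ℝ) :
    Prop where
  v_tail : ∀ k, d.N ≤ k → v k = 0
  α_tail : ∀ k, d.N ≤ k → α k = α d.N
  initial : x ∈ d.X (α 0)
  con : ∀ k ≤ d.N, ∀ j, ((d.F + d.G * d.K) * d.U j) *ᵥ α k + d.G *ᵥ v k ≤ 1
  eq : ∀ k ≤ d.N, ∀ j,
    Λ k j * d.MΘ = d.T * d.regD (d.U j *ᵥ α k) (d.K *ᵥ (d.U j *ᵥ α k) + v k)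
  le : ∀ k ≤ d.N, ∀ j,
    Λ k j *ᵥ μ ≤ α (k + 1) - d.T *ᵥ d.regd (d.U j *ᵥ α k) (d.K *ᵥ (d.U j *ᵥ α k) + v k) - d.wbar
  nonneg : ∀ k ≤ d.N, ∀ j i l, 0 ≤ Λ k j i l

lemma Feasible.isTube {μ : Fin r → ℝ} {θ : Fin p → ℝ} {ρ : Reference nx nu} {x : Fin nx → ℝ}
    {s : Decision nx nu p r na m} (h : d.Feasible μ θ ρ x s) : d.IsTube μ x s.v s.α s.Λ := by
  have hvN := h.v_tail d.N le_rfl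
  have hαN := h.α_tail (d.N + 1) (Nat.le_succ _)
  refine ⟨h.v_tail, h.α_tail, h.initial, fun k hk j => ?_, fun k hk j => ?_, fun k hk j => ?_,
    fun k hk j => ?_⟩ <;> rcases hk.lt_or_eq with hk | rfl
  · exact h.input_state k hk j
  · simpa [hvN] using h.final_con j
  · exact h.update_eq k hk j
  · simpa [hvN] using h.final_eq j
  · exact h.update_le k hk j
  · simpa only [hvN, hαN, add_zero] using h.final_le j
  · exact h.update_nonneg k hk j
  · exact h.final_nonneg j

/-- The nominal prediction. -/
def nom (d : Design nx nu p nc nw r na m) (θ : Fin p → ℝ) (x : Fin nx → ℝ) (v : ℕ → Fin nu → ℝ) :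
    ℕ → Fin nx → ℝ
  | 0 => x
  | k + 1 => d.Phi θ *ᵥ nom d θ x v k + d.Bθ θ *ᵥ v k

/-- The cost of a perturbation sequence, for vanishing weight of the excitation level. -/
noncomputable def J (d : Design nx nu p nc nw r na m) (θ : Fin p → ℝ) (x : Fin nx → ℝ) (v : ℕ → Fin nu → ℝ) : ℝ :=
  ∑ k ∈ Finset.range d.N, (wsq d.Q (d.nom θ x v k) + wsq d.R (d.K *ᵥ d.nom θ x v k + v k))
    + wsq (d.lyapP θ) (d.nom θ x v d.N)

lemma Feasible.xbar_eq {μ : Fin r → ℝ} {θ : Fin p → ℝ} {ρ : Reference nx nu} {x : Fin nx → ℝ}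
    {s : Decision nx nu p r na m} (h : d.Feasible μ θ ρ x s) : s.xbar = d.nom θ x s.v := by
  ext1 k
  induction k with
  | zero => exact h.nominal_zero
  | succ k ih => rw [h.nominal_step, ih, nom]

lemma Feasible.cost_eq {μ : Fin r → ℝ} {θ : Fin p → ℝ} {ρ : Reference nx nu} {x : Fin nx → ℝ}
    {s : Decision nx nu p r na m} (h : d.Feasible μ θ ρ x s) :
    d.cost 0 θ s = d.J θ x s.v := by
  simp [cost, J, h.xbar_eq, h.nominal_input]

/-- The excitation constraint can always be met, so that every tube extends to a decision. -/
lemma IsTube.exists_feasible {μ : Fin r → ℝ} {x : Fin nx → ℝ} {v : ℕ → Fin nu → ℝ}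
    {α : ℕ → Fin na → ℝ} {Λ : ℕ → Fin m → Matrix (Fin na) (Fin r) ℝ}
    (h : d.IsTube μ x v α Λ) (θ : Fin p → ℝ) (ρ : Reference nx nu) :
    ∃ s, d.Feasible μ θ ρ x s ∧ s.v = v := by
  have key : ∀ k, ∃ c : ℝ, ∀ j,
      ((d.regD (ρ.xhat k) (ρ.uhat k))ᵀ * d.regD (ρ.xhat k) (ρ.uhat k)
      + (d.regD (d.U j *ᵥ α k - ρ.xhat k)
          (d.K *ᵥ (d.U j *ᵥ α k) + v k - ρ.uhat k))ᵀ * d.regD (ρ.xhat k) (ρ.uhat k)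
      + (d.regD (ρ.xhat k) (ρ.uhat k))ᵀ * d.regD (d.U j *ᵥ α k - ρ.xhat k)
          (d.K *ᵥ (d.U j *ᵥ α k) + v k - ρ.uhat k)
      + c • (1 : Matrix (Fin p) (Fin p) ℝ)).PosSemidef := by
    intro k
    have hH : ∀ D E : Matrix (Fin nx) (Fin p) ℝ, (Dᵀ * D + Eᵀ * D + Dᵀ * E).IsHermitian := by
      intro D E
      simp only [Matrix.IsHermitian, Matrix.conjTranspose_eq_transpose_of_trivial,
        Matrix.transpose_add, Matrix.transpose_mul, Matrix.transpose_transpose]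
      abel
    choose c hc using fun j => exists_add_smul_one_posSemidef (hH (d.regD (ρ.xhat k) (ρ.uhat k))
      (d.regD (d.U j *ᵥ α k - ρ.xhat k) (d.K *ᵥ (d.U j *ᵥ α k) + v k - ρ.uhat k)))
    obtain ⟨C, hC⟩ := (Set.finite_range c).bddAbove
    exact ⟨C, fun j => hc j C (hC ⟨j, rfl⟩)⟩
  choose c hc using key
  have hvN := h.v_tail d.N le_rfl
  have hαN := h.α_tail (d.N + 1) (Nat.le_succ _)
  refine ⟨⟨v, α, d.nom θ x v, fun k => d.K *ᵥ d.nom θ x v k + v k,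
    ∑ k ∈ Finset.range d.Nu, -c k, Λ, fun k => -c k • 1⟩, ⟨h.v_tail, h.α_tail, h.initial,
    fun k hk => h.con k hk.le, fun k hk => h.eq k hk.le, fun k hk => h.le k hk.le,
    fun k hk => h.nonneg k hk.le, fun j => ?_, fun j => ?_, fun j => ?_, h.nonneg d.N le_rfl, rfl,
    fun _ => rfl, fun _ => rfl, fun k _ j => ?_, ?_⟩, rfl⟩
  · simpa [hvN] using h.con d.N le_rfl j
  · simpa [hvN] using h.eq d.N le_rfl j
  · simpa only [hvN, hαN, add_zero] using h.le d.N le_rfl j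
  · simpa using hc k j
  · have : ∑ k ∈ Finset.range d.Nu, -c k • (1 : Matrix (Fin p) (Fin p) ℝ)
        - (∑ k ∈ Finset.range d.Nu, -c k) • (1 : Matrix (Fin p) (Fin p) ℝ) = 0 := by
      rw [Finset.sum_smul, sub_self]
    simp only [this]
    exact Matrix.PosSemidef.zero

namespace IsTube

variable {μ : Fin r → ℝ} {x : Fin nx → ℝ} {v : ℕ → Fin nu → ℝ} {α : ℕ → Fin na → ℝ}
  {Λ : ℕ → Fin m → Matrix (Fin na) (Fin r) ℝ}

/-- Weak duality: `T D θ = Λ MΘ θ ≤ Λ μ` at each vertex, and the affine bound passes to the convex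
hull. The margin `wbar` absorbs `w`. -/
lemma step_mem (hd : d.Standing) (h : d.IsTube μ x v α Λ) {k : ℕ} (hk : k ≤ d.N)
    {θ : Fin p → ℝ} (hθ : θ ∈ d.Theta μ) {w : Fin nx → ℝ} (hw : w ∈ d.W) {y : Fin nx → ℝ}
    (hy : y ∈ d.X (α k)) : d.Phi θ *ᵥ y + d.Bθ θ *ᵥ v k + w ∈ d.X (α (k + 1)) := by
  have h1 : (d.T * d.Phi θ) *ᵥ y ≤ α (k + 1) - d.wbar - d.T *ᵥ (d.Bθ θ *ᵥ v k) := by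
    refine mulVec_le_of_mem_X hd _ (fun j i => ?_) hy
    have h2 := h.le k hk j i
    have h3 : (d.T *ᵥ (d.regD (d.U j *ᵥ α k) (d.K *ᵥ (d.U j *ᵥ α k) + v k) *ᵥ θ)) i
        ≤ (Λ k j *ᵥ μ) i := by
      rw [Matrix.mulVec_mulVec, ← h.eq k hk j, ← Matrix.mulVec_mulVec]
      exact mulVec_le_mulVec_of_nonneg (h.nonneg k hk j) hθ i
    have h4 := congrFun (congrArg (d.T *ᵥ ·) ((regD_mulVec_add_regd (d := d) θ (d.U j *ᵥ α k)
      (d.K *ᵥ (d.U j *ᵥ α k) + v k)).trans (closedLoop_eq _ _ _))) i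
    simp only [Matrix.mulVec_add, Pi.add_apply, Pi.sub_apply] at h2 h4 ⊢
    rw [← Matrix.mulVec_mulVec]
    linarith
  intro i
  have h2 := h1 i
  have h3 := mulVec_le_wbar hd hw i
  rw [← Matrix.mulVec_mulVec] at h2
  simp only [Matrix.mulVec_add, Pi.add_apply, Pi.sub_apply] at h2 ⊢
  linarith

lemma constraint (hd : d.Standing) (h : d.IsTube μ x v α Λ) {k : ℕ} (hk : k ≤ d.N)
    {y : Fin nx → ℝ} (hy : y ∈ d.X (α k)) :
    d.F *ᵥ y + d.G *ᵥ (d.K *ᵥ y + v k) ≤ 1 := by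
  have h1 : (d.F + d.G * d.K) *ᵥ y ≤ 1 - d.G *ᵥ v k := by
    refine mulVec_le_of_mem_X hd _ (fun j i => ?_) hy
    have h2 := h.con k hk j i
    rw [← Matrix.mulVec_mulVec] at h2
    simp only [Pi.add_apply, Pi.sub_apply] at h2 ⊢
    linarith
  intro i
  have h2 := h1 i
  simp only [Matrix.add_mulVec, Matrix.mulVec_add, ← Matrix.mulVec_mulVec, Pi.add_apply,
    Pi.sub_apply] at h2 ⊢
  linarith

lemma mono {μ' : Fin r → ℝ} (h : d.IsTube μ x v α Λ) (hμ : μ' ≤ μ) : d.IsTube μ' x v α Λ :=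
  { h with
    le := fun k hk j =>
      (mulVec_le_mulVec_of_nonneg (h.nonneg k hk j) hμ).trans (h.le k hk j) }

/-- The shifted tube. -/
lemma shift (h : d.IsTube μ x v α Λ) {x' : Fin nx → ℝ} (hx' : x' ∈ d.X (α 1)) :
    d.IsTube μ x' (fun k => v (k + 1)) (fun k => α (k + 1)) (fun k => Λ (min (k + 1) d.N)) := by
  have hvN := h.v_tail d.N le_rfl
  -- `Λ` has no tail convention and is constrained only up to index `N`, so the terminal certificate
  -- is reused beyond it.
  have key : ∀ k ≤ d.N, α (k + 1) = α (min (k + 1) d.N) ∧ v (k + 1) = v (min (k + 1) d.N) ∧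
      α (k + 1 + 1) = α (min (k + 1) d.N + 1) := by
    intro k hk
    rcases le_or_gt d.N (k + 1) with h1 | h1
    · rw [min_eq_right h1]
      exact ⟨h.α_tail _ h1, (h.v_tail _ h1).trans hvN.symm,
        (h.α_tail _ (by omega)).trans (h.α_tail _ (by omega)).symm⟩
    · rw [min_eq_left h1.le]; simp
  refine ⟨fun k hk => h.v_tail _ (by omega), fun k hk => ?_, hx', fun k hk j => ?_,
    fun k hk j => ?_, fun k hk j => ?_, fun k hk j => ?_⟩
  · rw [h.α_tail _ (by omega : d.N ≤ k + 1), h.α_tail _ (by omega : d.N ≤ d.N + 1)]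
  · rw [(key k hk).1, (key k hk).2.1]; exact h.con _ (min_le_right _ _) j
  · rw [(key k hk).1, (key k hk).2.1]; exact h.eq _ (min_le_right _ _) j
  · rw [(key k hk).1, (key k hk).2.1, (key k hk).2.2]; exact h.le _ (min_le_right _ _) j
  · exact h.nonneg _ (min_le_right _ _) j

/-- The terminal cross-section, used at all times without perturbation. -/
lemma terminal (h : d.IsTube μ x v α Λ) {y : Fin nx → ℝ} (hy : y ∈ d.X (α d.N)) :
    d.IsTube μ y 0 (fun _ => α d.N) (fun _ => Λ d.N) := by
  have hvN := h.v_tail d.N le_rfl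
  have hαN := h.α_tail (d.N + 1) (Nat.le_succ _)
  refine ⟨fun _ _ => rfl, fun _ _ => rfl, hy, fun k _ j => ?_, fun k _ j => ?_, fun k _ j => ?_,
    fun k _ => h.nonneg d.N le_rfl⟩
  · simpa [hvN] using h.con d.N le_rfl j
  · simpa [hvN] using h.eq d.N le_rfl j
  · simpa only [hvN, hαN, Pi.zero_apply] using h.le d.N le_rfl j

end IsTube

/-! ## Uniform exponential stability of the nominal loop -/

/-- Contractivity is positively homogeneous, so `T x ≤ c` decays geometrically under `Φ(θ)`, and
boundedness of `X 1` turns this into a norm bound uniform in `θ`. -/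
lemma exists_norm_Phi_pow_le (hd : d.Standing) : ∃ κ σ : ℝ, 0 < κ ∧ 0 < σ ∧ σ < 1 ∧
    ∀ θ ∈ d.Theta d.mu0, ∀ n : ℕ, ∀ x, ‖(d.Phi θ ^ n) *ᵥ x‖ ≤ κ * σ ^ n * ‖x‖ := by
  obtain ⟨lam, -, hl1, hlam⟩ := hd.contractive
  obtain ⟨ρ, hρ⟩ := hd.X_bounded.exists_norm_le
  obtain ⟨τ, hτ0, hτ⟩ := exists_norm_mulVec_le d.T
  -- `lam` may vanish, while the rescaling divides by `c * σ ^ n`.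
  set σ := max lam (1 / 2) with hσ
  have hσ0 : 0 < σ := lt_of_lt_of_le (by norm_num) (le_max_right _ _)
  have hσ1 : σ < 1 := max_lt hl1 (by norm_num)
  have hscale : ∀ {c : ℝ} {x : Fin nx → ℝ}, 0 < c → (∀ i, (d.T *ᵥ x) i ≤ c) →
      c⁻¹ • x ∈ d.X 1 := by
    intro c x hc hx i
    rw [Matrix.mulVec_smul, Pi.smul_apply, smul_eq_mul, Pi.one_apply, inv_mul_le_iff₀ hc, mul_one]
    exact hx i
  have hiter : ∀ θ ∈ d.Theta d.mu0, ∀ (c : ℝ) (x : Fin nx → ℝ), 0 < c →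
      (∀ i, (d.T *ᵥ x) i ≤ c) → ∀ n : ℕ, ∀ i, (d.T *ᵥ ((d.Phi θ ^ n) *ᵥ x)) i ≤ c * σ ^ n := by
    intro θ hθ c x hc hx n
    induction n with
    | zero => simpa using hx
    | succ n ih =>
      intro i
      have hc' : 0 < c * σ ^ n := by positivity
      have h := hlam _ (hscale hc' ih) θ hθ i
      rw [Matrix.mulVec_smul, Matrix.mulVec_smul, Pi.smul_apply, smul_eq_mul,
        inv_mul_le_iff₀ hc'] at h
      rw [pow_succ', ← Matrix.mulVec_mulVec]
      calc _ ≤ c * σ ^ n * lam := h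
        _ ≤ c * σ ^ n * σ := by gcongr; exact le_max_left _ _
        _ = _ := by ring
  have hρ0 : 0 ≤ ρ := (norm_nonneg _).trans (hρ 0 (by
    simp only [X, Set.mem_ofPred_eq, Matrix.mulVec_zero]; exact zero_le_one))
  refine ⟨(τ + 1) * (ρ + 1), σ, by positivity, hσ0, hσ1, fun θ hθ n x => ?_⟩
  rcases eq_or_ne x 0 with rfl | hx
  · simp
  have hx' : 0 < ‖x‖ := norm_pos_iff.2 hx
  have hc : 0 < (τ + 1) * ‖x‖ := by positivity
  have h1 := hiter θ hθ ((τ + 1) * ‖x‖) x hc (fun i => by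
    calc (d.T *ᵥ x) i ≤ ‖d.T *ᵥ x‖ := (le_abs_self _).trans (norm_le_pi_norm (d.T *ᵥ x) i)
      _ ≤ τ * ‖x‖ := hτ x
      _ ≤ _ := by gcongr; linarith) n
  have hc' : 0 < (τ + 1) * ‖x‖ * σ ^ n := by positivity
  have h2 := hρ _ (hscale hc' h1)
  rw [norm_smul, norm_inv, Real.norm_of_nonneg hc'.le, inv_mul_le_iff₀ hc'] at h2
  calc _ ≤ _ := h2
    _ ≤ (τ + 1) * ‖x‖ * σ ^ n * (ρ + 1) := by gcongr; linarith
    _ = _ := by ring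

lemma tendsto_Phi_pow_mulVec (hd : d.Standing) {θ : Fin p → ℝ} (hθ : θ ∈ d.Theta d.mu0)
    (x : Fin nx → ℝ) : Tendsto (fun n => (d.Phi θ ^ n) *ᵥ x) atTop (𝓝 0) := by
  obtain ⟨κ, σ, -, hσ0, hσ1, h⟩ := exists_norm_Phi_pow_le hd
  refine squeeze_zero_norm (h θ hθ · x) ?_
  simpa using ((tendsto_pow_atTop_nhds_zero_of_lt_one hσ0.le hσ1).const_mul κ).mul_const ‖x‖

/-! ## The Lyapunov equation -/

/-- Only existence is needed to evaluate the choice. A homogeneous solution satisfies `P = (Φⁿ)ᵀ P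
Φⁿ → 0`, so the Lyapunov operator is injective, hence surjective in finite dimension. -/
lemma lyapP_eq (hd : d.Standing) {θ : Fin p → ℝ} (hθ : θ ∈ d.Theta d.mu0) :
    d.lyapP θ - (d.Phi θ)ᵀ * d.lyapP θ * d.Phi θ = d.Q + d.Kᵀ * d.R * d.K := by
  let L : Matrix (Fin nx) (Fin nx) ℝ →ₗ[ℝ] Matrix (Fin nx) (Fin nx) ℝ :=
    { toFun := fun P => P - (d.Phi θ)ᵀ * P * d.Phi θ
      map_add' := fun P P' => by rw [Matrix.mul_add, Matrix.add_mul]; abel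
      map_smul' := fun c P => by simp [smul_sub] }
  have hinj : Function.Injective L := by
    rw [injective_iff_map_eq_zero]
    intro P hP
    have hP : P = (d.Phi θ)ᵀ * P * d.Phi θ := sub_eq_zero.1 hP
    have hstep : ∀ x y : Fin nx → ℝ, x ⬝ᵥ (P *ᵥ y) = (d.Phi θ *ᵥ x) ⬝ᵥ (P *ᵥ (d.Phi θ *ᵥ y)) := by
      intro x y
      conv_lhs => rw [hP]
      rw [← Matrix.mulVec_mulVec, ← Matrix.mulVec_mulVec, Matrix.dotProduct_mulVec,
        Matrix.vecMul_transpose]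
    have hn : ∀ (n : ℕ) (x y : Fin nx → ℝ),
        x ⬝ᵥ (P *ᵥ y) = ((d.Phi θ ^ n) *ᵥ x) ⬝ᵥ (P *ᵥ ((d.Phi θ ^ n) *ᵥ y)) := by
      intro n
      induction n with
      | zero => simp
      | succ n ih =>
        intro x y
        rw [hstep, ih, pow_succ, ← Matrix.mulVec_mulVec, ← Matrix.mulVec_mulVec]
    have hz : ∀ x y : Fin nx → ℝ, x ⬝ᵥ (P *ᵥ y) = 0 := by
      intro x y
      have hc : Continuous fun q : (Fin nx → ℝ) × (Fin nx → ℝ) => q.1 ⬝ᵥ (P *ᵥ q.2) := by fun_prop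
      have h1 := (hc.tendsto (0, 0)).comp
        ((tendsto_Phi_pow_mulVec hd hθ x).prodMk_nhds (tendsto_Phi_pow_mulVec hd hθ y))
      refine tendsto_nhds_unique (tendsto_const_nhds.congr fun n => hn n x y) (h1.trans ?_)
      simp
    ext i j
    have := hz (Pi.single i 1) (Pi.single j 1)
    simpa using this
  obtain ⟨P, hP⟩ := LinearMap.injective_iff_surjective.1 hinj (d.Q + d.Kᵀ * d.R * d.K)
  exact Classical.epsilon_spec (p := fun P => P - (d.Phi θ)ᵀ * P * d.Phi θ
    = d.Q + d.Kᵀ * d.R * d.K) ⟨P, hP⟩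

lemma wsq_lyapP (hd : d.Standing) {θ : Fin p → ℝ} (hθ : θ ∈ d.Theta d.mu0) (x : Fin nx → ℝ) :
    wsq (d.lyapP θ) x = wsq d.Q x + wsq d.R (d.K *ᵥ x) + wsq (d.lyapP θ) (d.Phi θ *ᵥ x) := by
  have h : wsq (d.lyapP θ - (d.Phi θ)ᵀ * d.lyapP θ * d.Phi θ) x
      = wsq (d.Q + d.Kᵀ * d.R * d.K) x := by rw [lyapP_eq hd hθ]
  have hT : ∀ {k : ℕ} (A : Matrix (Fin k) (Fin nx) ℝ) (S : Matrix (Fin k) (Fin k) ℝ),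
      x ⬝ᵥ ((Aᵀ * S * A) *ᵥ x) = wsq S (A *ᵥ x) := by
    intro k A S
    rw [← Matrix.mulVec_mulVec, ← Matrix.mulVec_mulVec, Matrix.dotProduct_mulVec,
      Matrix.vecMul_transpose, wsq]
  simp only [wsq, Matrix.sub_mulVec, Matrix.add_mulVec, dotProduct_sub, dotProduct_add, hT] at h
  simp only [wsq] at h ⊢
  linarith

/-- The Lyapunov identity telescopes along `Φⁿ x`, and the geometric decay bounds the sum.
Uniformity in `θ` comes from that of the decay, without continuity of `P(θ)`. -/
lemma exists_wsq_lyapP_le (hd : d.Standing) : ∃ C : ℝ, 0 ≤ C ∧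
    ∀ θ ∈ d.Theta d.mu0, ∀ x, 0 ≤ wsq (d.lyapP θ) x ∧ wsq (d.lyapP θ) x ≤ C * ‖x‖ ^ 2 := by
  obtain ⟨κ, σ, hκ, hσ0, hσ1, h⟩ := exists_norm_Phi_pow_le hd
  obtain ⟨q, hq0, hq⟩ := exists_abs_wsq_le d.Q
  obtain ⟨s, hs0, hs⟩ := exists_abs_wsq_le d.R
  obtain ⟨k, hk0, hk⟩ := exists_norm_mulVec_le d.K
  have hσ2 : σ ^ 2 < 1 := by nlinarith
  have hs2 : 0 < 1 - σ ^ 2 := by linarith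
  set g := q + s * k ^ 2 with hg
  have hg0 : 0 ≤ g := by positivity
  have hstage : ∀ x, wsq d.Q x + wsq d.R (d.K *ᵥ x) ≤ g * ‖x‖ ^ 2 := by
    intro x
    have h1 := le_of_abs_le (hq x)
    have h2 := le_of_abs_le (hs (d.K *ᵥ x))
    have h3 : s * ‖d.K *ᵥ x‖ ^ 2 ≤ s * (k * ‖x‖) ^ 2 := by gcongr; exact hk x
    rw [hg]; nlinarith
  refine ⟨g * κ ^ 2 / (1 - σ ^ 2), by positivity, fun θ hθ x => ?_⟩
  have hlim : Tendsto (fun n => wsq (d.lyapP θ) ((d.Phi θ ^ n) *ᵥ x)) atTop (𝓝 0) := by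
    have := ((continuous_wsq (d.lyapP θ)).tendsto 0).comp (tendsto_Phi_pow_mulVec hd hθ x)
    rwa [wsq_zero] at this
  have hrec : ∀ n : ℕ, wsq (d.lyapP θ) ((d.Phi θ ^ n) *ᵥ x) =
      (wsq d.Q ((d.Phi θ ^ n) *ᵥ x) + wsq d.R (d.K *ᵥ ((d.Phi θ ^ n) *ᵥ x)))
        + wsq (d.lyapP θ) ((d.Phi θ ^ (n + 1)) *ᵥ x) := by
    intro n
    rw [wsq_lyapP hd hθ, pow_succ', ← Matrix.mulVec_mulVec]
  constructor
  · refine le_of_tendsto' hlim fun n => ?_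
    induction n with
    | zero => simp
    | succ n ih =>
      have := hrec n
      have h1 := wsq_nonneg hd.Q_pos ((d.Phi θ ^ n) *ᵥ x)
      have h2 := wsq_nonneg hd.R_pos (d.K *ᵥ ((d.Phi θ ^ n) *ᵥ x))
      linarith
  · have key : ∀ n : ℕ, wsq (d.lyapP θ) x ≤ g * κ ^ 2 / (1 - σ ^ 2) * ‖x‖ ^ 2 * (1 - (σ ^ 2) ^ n)
        + wsq (d.lyapP θ) ((d.Phi θ ^ n) *ᵥ x) := by
      intro n
      induction n with
      | zero => simp
      | succ n ih =>
        have h1 := hstage ((d.Phi θ ^ n) *ᵥ x)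
        have h2 : g * ‖(d.Phi θ ^ n) *ᵥ x‖ ^ 2 ≤ g * (κ * σ ^ n * ‖x‖) ^ 2 := by
          gcongr; exact h θ hθ n x
        have h3 : g * (κ * σ ^ n * ‖x‖) ^ 2 = g * κ ^ 2 / (1 - σ ^ 2) * ‖x‖ ^ 2 *
            ((σ ^ 2) ^ n - (σ ^ 2) ^ (n + 1)) := by
          rw [pow_succ (σ ^ 2) n]; field_simp; ring
        have h4 := hrec n
        linarith
    have hlim2 : Tendsto (fun n : ℕ => g * κ ^ 2 / (1 - σ ^ 2) * ‖x‖ ^ 2 * (1 - (σ ^ 2) ^ n)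
        + wsq (d.lyapP θ) ((d.Phi θ ^ n) *ᵥ x)) atTop
        (𝓝 (g * κ ^ 2 / (1 - σ ^ 2) * ‖x‖ ^ 2 * (1 - 0) + 0)) :=
      ((tendsto_const_nhds.sub
        (tendsto_pow_atTop_nhds_zero_of_lt_one (by positivity) hσ2)).const_mul _).add hlim
    simpa using ge_of_tendsto' hlim2 key

/-! ## Bounds on states, inputs and cost -/

lemma exists_norm_Bθ_le (hd : d.Standing) : ∃ C : ℝ, 0 ≤ C ∧
    ∀ θ ∈ d.Theta d.mu0, ∀ v, ‖d.Bθ θ *ᵥ v‖ ≤ C * ‖v‖ := by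
  obtain ⟨ρ, hρ⟩ := hd.Theta_bounded.exists_norm_le
  obtain ⟨b, hb0, hb⟩ := exists_norm_mulVec_le d.B0
  choose c hc0 hc using fun i => exists_norm_mulVec_le (d.B i)
  have hs : 0 ≤ ∑ i, c i := Finset.sum_nonneg fun i _ => hc0 i
  refine ⟨b + |ρ| * ∑ i, c i, by positivity, fun θ hθ v => ?_⟩
  have h1 : d.Bθ θ *ᵥ v = d.B0 *ᵥ v + ∑ i, θ i • (d.B i *ᵥ v) := by
    simp [Bθ, Matrix.add_mulVec, Matrix.sum_mulVec, Matrix.smul_mulVec]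
  rw [h1]
  calc _ ≤ ‖d.B0 *ᵥ v‖ + ∑ i, ‖θ i • (d.B i *ᵥ v)‖ :=
        (norm_add_le _ _).trans (by gcongr; exact norm_sum_le _ _)
    _ ≤ b * ‖v‖ + ∑ i, |ρ| * (c i * ‖v‖) := by
        gcongr with i
        · exact hb v
        · rw [norm_smul]
          gcongr
          · exact (norm_le_pi_norm θ i).trans ((hρ θ hθ).trans (le_abs_self _))
          · exact hc i v
    _ = _ := by rw [← Finset.mul_sum, ← Finset.sum_mul]; ring

lemma exists_Z_bound (hd : d.Standing) : ∃ C : ℝ, 0 ≤ C ∧ ∀ x u,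
    d.F *ᵥ x + d.G *ᵥ u ≤ 1 → ‖x‖ ≤ C ∧ ‖u‖ ≤ C := by
  obtain ⟨ρ, hρ⟩ := hd.Z_compact.isBounded.exists_norm_le
  refine ⟨|ρ|, abs_nonneg _, fun x u h => ?_⟩
  have h1 := (hρ (x, u) h).trans (le_abs_self ρ)
  exact ⟨(norm_fst_le (x, u)).trans h1, (norm_snd_le (x, u)).trans h1⟩

/-- All feasible states and perturbations are bounded. -/
lemma exists_tube_bound (hd : d.Standing) : ∃ C : ℝ, 0 ≤ C ∧ ∀ μ x v α Λ,
    d.IsTube μ x v α Λ → ‖x‖ ≤ C ∧ ∀ k, ‖v k‖ ≤ C := by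
  obtain ⟨z, hz0, hz⟩ := exists_Z_bound hd
  obtain ⟨c, hc0, hc⟩ := exists_norm_mulVec_le d.K
  refine ⟨z + c * z, by positivity, fun μ x v α Λ h => ⟨?_, fun k => ?_⟩⟩
  · have := (hz _ _ (h.constraint hd (Nat.zero_le _) h.initial)).1
    have : 0 ≤ c * z := by positivity
    linarith
  · rcases le_or_gt d.N k with hk | hk
    · rw [h.v_tail k hk, norm_zero]; positivity
    -- The vertex constraint puts the pair `(U j α, K U j α + v)` itself into `Z`, whether or not `U
    -- j α` lies in the cross-section.
    obtain ⟨j⟩ := nonempty_vertices hd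
    have h1 := h.con k hk.le j
    have h2 : d.F *ᵥ (d.U j *ᵥ α k) + d.G *ᵥ (d.K *ᵥ (d.U j *ᵥ α k) + v k) ≤ 1 := by
      convert h1 using 1
      simp only [Matrix.add_mulVec, Matrix.mulVec_add, ← Matrix.mulVec_mulVec]
      abel
    obtain ⟨h3, h4⟩ := hz _ _ h2
    calc ‖v k‖ = ‖(d.K *ᵥ (d.U j *ᵥ α k) + v k) - d.K *ᵥ (d.U j *ᵥ α k)‖ := by
          rw [add_sub_cancel_left]
      _ ≤ z + c * z := (norm_sub_le _ _).trans (add_le_add h4 ((hc _).trans (by gcongr)))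

lemma exists_J_le (hd : d.Standing) (z : ℝ) : ∃ C : ℝ, 0 ≤ C ∧ ∀ θ ∈ d.Theta d.mu0, ∀ x v,
    ‖x‖ ≤ z → (∀ k, ‖v k‖ ≤ z) → d.J θ x v ≤ C := by
  obtain ⟨κ, σ, hκ, hσ0, -, hΦ⟩ := exists_norm_Phi_pow_le hd
  obtain ⟨b, hb0, hb⟩ := exists_norm_Bθ_le hd
  obtain ⟨q, hq0, hq⟩ := exists_abs_wsq_le d.Q
  obtain ⟨s, hs0, hs⟩ := exists_abs_wsq_le d.R
  obtain ⟨c, hc0, hc⟩ := exists_norm_mulVec_le d.K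
  obtain ⟨P, hP0, hP⟩ := exists_wsq_lyapP_le hd
  have hn : ∀ k, ∃ C : ℝ, ∀ θ ∈ d.Theta d.mu0, ∀ x v,
      ‖x‖ ≤ z → (∀ k, ‖v k‖ ≤ z) → ‖d.nom θ x v k‖ ≤ C := by
    intro k
    induction k with
    | zero => exact ⟨z, fun θ _ x v hx _ => hx⟩
    | succ k ih =>
      obtain ⟨C, hC⟩ := ih
      refine ⟨κ * σ * C + b * z, fun θ hθ x v hx hv => ?_⟩
      have h1 := hΦ θ hθ 1 (d.nom θ x v k)
      rw [pow_one, pow_one] at h1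
      refine (norm_add_le _ _).trans (add_le_add (h1.trans ?_) ((hb θ hθ _).trans ?_))
      · gcongr; exact hC θ hθ x v hx hv
      · gcongr; exact hv k
  choose C hC using hn
  refine ⟨∑ k ∈ Finset.range d.N, (q * C k ^ 2 + s * (c * C k + z) ^ 2) + P * C d.N ^ 2,
    by positivity, fun θ hθ x v hx hv => ?_⟩
  unfold J
  have hC' := fun k => hC k θ hθ x v hx hv
  gcongr with k
  · exact (le_of_abs_le (hq _)).trans (by gcongr; exact hC' k)
  · refine (le_of_abs_le (hs _)).trans ?_
    gcongr
    exact (norm_add_le _ _).trans (add_le_add ((hc _).trans (by gcongr; exact hC' k)) (hv k))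
  · exact (hP θ hθ _).2.trans (by gcongr; exact hC' d.N)

/-! ## Properties of the cost -/

lemma nom_add (θ : Fin p → ℝ) (a e : Fin nx → ℝ) (v : ℕ → Fin nu → ℝ) (k : ℕ) :
    d.nom θ (a + e) v k = d.nom θ a v k + d.nom θ e 0 k := by
  induction k with
  | zero => rfl
  | succ k ih =>
    simp only [nom, ih, Matrix.mulVec_add, Pi.zero_apply, Matrix.mulVec_zero]; abel

lemma nom_shift (θ : Fin p → ℝ) (x : Fin nx → ℝ) (v : ℕ → Fin nu → ℝ) (k : ℕ) :
    d.nom θ (d.nom θ x v 1) (fun k => v (k + 1)) k = d.nom θ x v (k + 1) := by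
  induction k with
  | zero => rfl
  | succ k ih =>
    change d.Phi θ *ᵥ d.nom θ _ _ k + _ = _
    rw [ih]; rfl

lemma J_zero (hd : d.Standing) {θ : Fin p → ℝ} (hθ : θ ∈ d.Theta d.mu0) (x : Fin nx → ℝ) :
    d.J θ x 0 = wsq (d.lyapP θ) x := by
  have key : ∀ n, ∑ k ∈ Finset.range n, (wsq d.Q (d.nom θ x 0 k)
      + wsq d.R (d.K *ᵥ d.nom θ x 0 k + (0 : ℕ → Fin nu → ℝ) k))
      + wsq (d.lyapP θ) (d.nom θ x 0 n) = wsq (d.lyapP θ) x := by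
    intro n
    induction n with
    | zero => simp [nom]
    | succ n ih =>
      rw [← ih, Finset.sum_range_succ, wsq_lyapP hd hθ (d.nom θ x 0 n)]
      simp only [nom, Pi.zero_apply, Matrix.mulVec_zero, add_zero]
      ring
  exact key d.N

/-- The terminal cost splits into one more unperturbed stage and the next terminal cost, so the
shift loses exactly the first stage. The condition `v d.N = 0` makes the added stage unperturbed. -/
lemma J_shift (hd : d.Standing) {θ : Fin p → ℝ} (hθ : θ ∈ d.Theta d.mu0) (x : Fin nx → ℝ)
    {v : ℕ → Fin nu → ℝ} (hv : v d.N = 0) :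
    d.J θ (d.nom θ x v 1) (fun k => v (k + 1))
      = d.J θ x v - (wsq d.Q x + wsq d.R (d.K *ᵥ x + v 0)) := by
  simp only [J, nom_shift]
  have h1 := Finset.sum_range_succ' (fun k => wsq d.Q (d.nom θ x v k)
    + wsq d.R (d.K *ᵥ d.nom θ x v k + v k)) d.N
  have h2 := Finset.sum_range_succ (fun k => wsq d.Q (d.nom θ x v k)
    + wsq d.R (d.K *ᵥ d.nom θ x v k + v k)) d.N
  have h3 := wsq_lyapP hd hθ (d.nom θ x v d.N)
  have h4 : d.nom θ x v (d.N + 1) = d.Phi θ *ᵥ d.nom θ x v d.N := by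
    simp [nom, hv]
  rw [h4]
  rw [hv, add_zero] at h2
  have h5 : d.nom θ x v 0 = x := rfl
  rw [h5] at h1
  linarith

/-- By superposition the deviation is the unperturbed response to `e`, whose total cost is the
`P`-form of `e` by `J_zero`; Young's inequality applies termwise. -/
lemma J_add_le (hd : d.Standing) {θ : Fin p → ℝ} (hθ : θ ∈ d.Theta d.mu0) {δ : ℝ} (hδ : 0 < δ)
    (a e : Fin nx → ℝ) (v : ℕ → Fin nu → ℝ) :
    d.J θ (a + e) v ≤ (1 + δ) * d.J θ a v + (1 + δ⁻¹) * wsq (d.lyapP θ) e := by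
  obtain ⟨_, -, hP⟩ := exists_wsq_lyapP_le hd
  rw [← J_zero hd hθ e]
  simp only [J, mul_add, Finset.mul_sum, nom_add]
  rw [add_add_add_comm, ← Finset.sum_add_distrib]
  refine add_le_add (Finset.sum_le_sum fun k _ => ?_) ?_
  · have h1 := wsq_add_le (wsq_nonneg hd.Q_pos) hδ (d.nom θ a v k) (d.nom θ e 0 k)
    have h2 := wsq_add_le (wsq_nonneg hd.R_pos) hδ (d.K *ᵥ d.nom θ a v k + v k)
      (d.K *ᵥ d.nom θ e 0 k + (0 : ℕ → Fin nu → ℝ) k)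
    have h3 : d.K *ᵥ (d.nom θ a v k + d.nom θ e 0 k) + v k = d.K *ᵥ d.nom θ a v k + v k
        + (d.K *ᵥ d.nom θ e 0 k + (0 : ℕ → Fin nu → ℝ) k) := by
      rw [Matrix.mulVec_add, Pi.zero_apply]; abel
    rw [h3]
    linarith
  · exact wsq_add_le (fun x => (hP θ hθ x).1) hδ _ _

lemma wsq_Q_le_J (hd : d.Standing) {θ : Fin p → ℝ} (hθ : θ ∈ d.Theta d.mu0) (x : Fin nx → ℝ)
    (v : ℕ → Fin nu → ℝ) : wsq d.Q x ≤ d.J θ x v := by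
  obtain ⟨_, -, hP⟩ := exists_wsq_lyapP_le hd
  have h1 : ∀ k ∈ Finset.range d.N, 0 ≤ wsq d.Q (d.nom θ x v k)
      + wsq d.R (d.K *ᵥ d.nom θ x v k + v k) := fun k _ =>
    add_nonneg (wsq_nonneg hd.Q_pos _) (wsq_nonneg hd.R_pos _)
  have h2 := Finset.single_le_sum h1 (Finset.mem_range.2 hd.N_pos)
  have h3 : wsq d.Q x ≤ wsq d.Q (d.nom θ x v 0) + wsq d.R (d.K *ᵥ d.nom θ x v 0 + v 0) :=
    le_add_of_nonneg_right (wsq_nonneg hd.R_pos _)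
  exact (h3.trans h2).trans (le_add_of_nonneg_right (hP θ hθ _).1)

/-! ## The terminal set -/

/-- The terminal section is closed, nonempty and invariant under `y ↦ Φ(θ) y + w`. Iterating with `w
= 0` puts the origin in it, and one step from the origin reaches any `w`. -/
lemma IsTube.W_subset (hd : d.Standing) {μ : Fin r → ℝ} {x : Fin nx → ℝ} {v : ℕ → Fin nu → ℝ}
    {α : ℕ → Fin na → ℝ} {Λ : ℕ → Fin m → Matrix (Fin na) (Fin r) ℝ} (h : d.IsTube μ x v α Λ)
    {θ : Fin p → ℝ} (hθ : θ ∈ d.Theta μ) (hθ0 : θ ∈ d.Theta d.mu0) : d.W ⊆ d.X (α d.N) := by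
  have hne : ∀ k ≤ d.N, (d.X (α k)).Nonempty := by
    intro k
    induction k with
    | zero => exact fun _ => ⟨x, h.initial⟩
    | succ k ih =>
      intro hk
      obtain ⟨y, hy⟩ := ih (by omega)
      exact ⟨_, h.step_mem hd (by omega) hθ (zero_mem_W hd) hy⟩
  have hstep : ∀ w ∈ d.W, ∀ y ∈ d.X (α d.N), d.Phi θ *ᵥ y + w ∈ d.X (α d.N) := by
    intro w hw y hy
    have := h.step_mem hd le_rfl hθ hw hy
    rwa [h.v_tail _ le_rfl, h.α_tail _ (Nat.le_succ _), Matrix.mulVec_zero, add_zero] at this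
  obtain ⟨y, hy⟩ := hne _ le_rfl
  have hpow : ∀ n : ℕ, (d.Phi θ ^ n) *ᵥ y ∈ d.X (α d.N) := by
    intro n
    induction n with
    | zero => simpa using hy
    | succ n ih =>
      rw [pow_succ', ← Matrix.mulVec_mulVec]
      simpa using hstep 0 (zero_mem_W hd) _ ih
  have hclosed : IsClosed (d.X (α d.N)) := by
    have : Continuous fun x : Fin nx → ℝ => d.T *ᵥ x := by fun_prop
    exact isClosed_le this continuous_const
  have h0 : (0 : Fin nx → ℝ) ∈ d.X (α d.N) :=
    hclosed.mem_of_tendsto (tendsto_Phi_pow_mulVec hd hθ0 y) (Eventually.of_forall hpow)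
  intro w hw
  simpa using hstep w hw 0 h0

/-- Whenever the problem is feasible, it has a feasible point of quadratically bounded cost. -/
lemma exists_quadratic_bound (hd : d.Standing) : ∃ C : ℝ, 0 ≤ C ∧ ∀ θbar ∈ d.Theta d.mu0,
    ∀ μ, ∀ θ ∈ d.Theta μ, θ ∈ d.Theta d.mu0 → ∀ x v α Λ, d.IsTube μ x v α Λ →
      ∃ v' α' Λ', d.IsTube μ x v' α' Λ' ∧ d.J θbar x v' ≤ C * ‖x‖ ^ 2 := by
  obtain ⟨P, hP0, hP⟩ := exists_wsq_lyapP_le hd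
  obtain ⟨z, hz0, hz⟩ := exists_tube_bound hd
  obtain ⟨V, hV0, hV⟩ := exists_J_le hd z
  obtain ⟨ε, hε, hball⟩ := Metric.mem_nhds_iff.1 (W_mem_nhds hd)
  -- `P` serves the ball of radius `ε` inside `W`; outside it the uniform cost bound `V` is at most
  -- `V / ε² * ‖x‖²`.
  refine ⟨P + V / ε ^ 2, by positivity, fun θbar hθbar μ θ hθ hθ0 x v α Λ h => ?_⟩
  have hVε : 0 ≤ V / ε ^ 2 := by positivity
  rcases lt_or_ge ‖x‖ ε with hx | hx
  · refine ⟨_, _, _, h.terminal (h.W_subset hd hθ hθ0 (hball (by simpa using hx))), ?_⟩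
    rw [J_zero hd hθbar]
    refine (hP θbar hθbar x).2.trans ?_
    gcongr; linarith
  · obtain ⟨h1, h2⟩ := hz _ _ _ _ _ h
    refine ⟨v, α, Λ, h, (hV θbar hθbar x v h1 h2).trans ?_⟩
    calc V = V / ε ^ 2 * ε ^ 2 := by field_simp
      _ ≤ (P + V / ε ^ 2) * ‖x‖ ^ 2 := by gcongr; linarith

/-! ## Existence of optimal solutions -/

lemma continuous_nom (θ : Fin p → ℝ) (x : Fin nx → ℝ) (k : ℕ) :
    Continuous fun v => d.nom θ x v k := by
  induction k with
  | zero => exact continuous_const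
  | succ k ih => simp only [nom]; fun_prop

lemma continuous_J (θ : Fin p → ℝ) (x : Fin nx → ℝ) : Continuous fun v => d.J θ x v := by
  have h := fun k => continuous_nom (d := d) θ x k
  have hQ := continuous_wsq d.Q
  have hR := continuous_wsq d.R
  have hP := continuous_wsq (d.lyapP θ)
  unfold J
  fun_prop

lemma mul_regD_apply (x : Fin nx → ℝ) (u : Fin nu → ℝ) (a : Fin na) (l : Fin p) :
    (d.T * d.regD x u) a l = (d.T *ᵥ (d.A l *ᵥ x + d.B l *ᵥ u)) a := rfl

lemma isLinearSystem_con (k k' : ℕ) (j : Fin m) :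
    IsLinearSystem fun (v : ℕ → Fin nu → ℝ)
      (y : (ℕ → Fin na → ℝ) × (ℕ → Fin m → Matrix (Fin na) (Fin r) ℝ)) =>
      ((d.F + d.G * d.K) * d.U j) *ᵥ y.1 k' + d.G *ᵥ v k ≤ 1 := by
  simp only [Pi.le_def]
  refine .forall_finite fun i => .single
    { toFun := fun y => (((d.F + d.G * d.K) * d.U j) *ᵥ y.1 k') i
      map_add' := fun y y' => by simp [Matrix.mulVec_add]
      map_smul' := fun c y => by simp [Matrix.mulVec_smul] }
    (g := fun v => 1 - (d.G *ᵥ v k) i) (by fun_prop) fun v y => ?_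
  simp [le_sub_iff_add_le]

lemma isLinearSystem_eq (k k' : ℕ) (j : Fin m) :
    IsLinearSystem fun (v : ℕ → Fin nu → ℝ)
      (y : (ℕ → Fin na → ℝ) × (ℕ → Fin m → Matrix (Fin na) (Fin r) ℝ)) =>
      y.2 k j * d.MΘ = d.T * d.regD (d.U j *ᵥ y.1 k') (d.K *ᵥ (d.U j *ᵥ y.1 k') + v k) := by
  simp only [← Matrix.ext_iff, mul_regD_apply]
  refine .forall_finite fun a => .forall_finite fun l => .eq
    { toFun := fun y => (y.2 k j * d.MΘ) a l
        - (d.T *ᵥ (d.A l *ᵥ (d.U j *ᵥ y.1 k') + d.B l *ᵥ (d.K *ᵥ (d.U j *ᵥ y.1 k')))) a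
      map_add' := fun y y' => by simp [Matrix.mulVec_add, Matrix.add_mul]; ring
      map_smul' := fun c y => by simp [Matrix.mulVec_smul, Matrix.mulVec_add]; ring }
    (g := fun v => (d.T *ᵥ (d.B l *ᵥ v k)) a) (by fun_prop) fun v y => ?_
  simp only [LinearMap.coe_mk, AddHom.coe_mk, Matrix.mulVec_add, Pi.add_apply]
  constructor <;> intro h <;> linarith

lemma isLinearSystem_le (μ : Fin r → ℝ) (k k' k'' : ℕ) (j : Fin m) :
    IsLinearSystem fun (v : ℕ → Fin nu → ℝ)
      (y : (ℕ → Fin na → ℝ) × (ℕ → Fin m → Matrix (Fin na) (Fin r) ℝ)) =>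
      y.2 k j *ᵥ μ ≤ y.1 k''
        - d.T *ᵥ d.regd (d.U j *ᵥ y.1 k') (d.K *ᵥ (d.U j *ᵥ y.1 k') + v k) - d.wbar := by
  simp only [Pi.le_def, regd]
  refine .forall_finite fun i => .single
    { toFun := fun y => (y.2 k j *ᵥ μ) i - y.1 k'' i
        + (d.T *ᵥ (d.A0 *ᵥ (d.U j *ᵥ y.1 k') + d.B0 *ᵥ (d.K *ᵥ (d.U j *ᵥ y.1 k')))) i
      map_add' := fun y y' => by simp [Matrix.mulVec_add, Matrix.add_mulVec]; ring
      map_smul' := fun c y => by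
        simp [Matrix.mulVec_smul, Matrix.mulVec_add, Matrix.smul_mulVec]; ring }
    (g := fun v => -(d.T *ᵥ (d.B0 *ᵥ v k)) i - d.wbar i) (by fun_prop) fun v y => ?_
  simp only [LinearMap.coe_mk, AddHom.coe_mk, Matrix.mulVec_add, Pi.add_apply, Pi.sub_apply]
  constructor <;> intro h <;> linarith

/-- For fixed `μ` the constraints are linear in `(α, Λ)` jointly, with `v` on the right-hand side.
Replacing `α (k + 1)` by `α (min (k + 1) N)` removes the infinite tail condition and leaves a finite
system. -/
lemma isClosed_tube (μ : Fin r → ℝ) (x : Fin nx → ℝ) :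
    IsClosed {v | ∃ α Λ, d.IsTube μ x v α Λ} := by
  have hsys : IsLinearSystem fun (v : ℕ → Fin nu → ℝ)
      (y : (ℕ → Fin na → ℝ) × (ℕ → Fin m → Matrix (Fin na) (Fin r) ℝ)) =>
      (∀ i, (d.T *ᵥ x) i ≤ y.1 0 i) ∧ ∀ k : Fin (d.N + 1), ∀ j,
        ((((d.F + d.G * d.K) * d.U j) *ᵥ y.1 k + d.G *ᵥ v k ≤ 1) ∧
        y.2 k j * d.MΘ = d.T * d.regD (d.U j *ᵥ y.1 k) (d.K *ᵥ (d.U j *ᵥ y.1 k) + v k)) ∧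
        (y.2 k j *ᵥ μ ≤ y.1 (min (k + 1) d.N)
          - d.T *ᵥ d.regd (d.U j *ᵥ y.1 k) (d.K *ᵥ (d.U j *ᵥ y.1 k) + v k) - d.wbar) ∧
        ∀ i l, 0 ≤ y.2 k j i l := by
    refine .and (.forall_finite fun i => .single
        { toFun := fun y => -y.1 0 i
          map_add' := fun y y' => by simp; ring
          map_smul' := fun c y => by simp }
        (g := fun _ => -(d.T *ᵥ x) i) continuous_const fun v y => by simp)
      (.forall_finite fun k => .forall_finite fun j =>
        .and (.and (isLinearSystem_con _ _ j) (isLinearSystem_eq _ _ j))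
          (.and (isLinearSystem_le μ _ _ _ j)
            (.forall_finite fun i => .forall_finite fun l => .single
              { toFun := fun y => -y.2 k j i l
                map_add' := fun y y' => by simp; ring
                map_smul' := fun c y => by simp }
              (g := fun _ => 0) continuous_const fun v y => by simp)))
  have htail : IsClosed {v : ℕ → Fin nu → ℝ | ∀ k, d.N ≤ k → v k = 0} := by
    simp only [Set.ofPred_forall]
    exact isClosed_iInter fun k => isClosed_iInter fun _ =>
      isClosed_eq (continuous_apply k) continuous_const
  convert htail.inter hsys.isClosed using 1
  ext v
  constructor
  · rintro ⟨α, Λ, h⟩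
    refine ⟨h.v_tail, (α, Λ), h.initial, fun k j => ?_⟩
    have hk : (k : ℕ) ≤ d.N := Nat.lt_succ_iff.1 k.2
    have hα : α (min ((k : ℕ) + 1) d.N) = α (k + 1) := by
      rcases le_total ((k : ℕ) + 1) d.N with h1 | h1
      · rw [min_eq_left h1]
      · rw [min_eq_right h1, h.α_tail _ h1]
    refine ⟨⟨h.con k hk j, h.eq k hk j⟩, ?_, h.nonneg k hk j⟩
    simp only [hα]
    exact h.le k hk j
  · rintro ⟨hv, ⟨α, Λ⟩, h0, h⟩
    have h' := fun (k : ℕ) (hk : k ≤ d.N) j => h ⟨k, Nat.lt_succ_iff.2 hk⟩ j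
    refine ⟨fun k => α (min k d.N), Λ, hv, fun k hk => by simp [hk], fun i => by simpa using h0 i,
      fun k hk j => ?_, fun k hk j => ?_, fun k hk j => ?_, fun k hk j => (h' k hk j).2.2⟩ <;>
      simp only [min_eq_left hk]
    exacts [(h' k hk j).1.1, (h' k hk j).1.2, (h' k hk j).2.1]

/-- Only `v` enters the cost. Its admissible set is closed and lies in a product of balls, compact
by Tychonoff. -/
theorem exists_isOptimal (hd : d.Standing) {μ : Fin r → ℝ} {θ : Fin p → ℝ} {ρ : Reference nx nu}
    {x : Fin nx → ℝ} (h : d.IsFeasible μ θ ρ x) : ∃ s, d.IsOptimal 0 μ θ ρ x s := by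
  obtain ⟨s₀, hs₀⟩ := h
  obtain ⟨C, -, hC⟩ := exists_tube_bound hd
  have hcomp : IsCompact {v | ∃ α Λ, d.IsTube μ x v α Λ} := by
    refine (isCompact_univ_pi fun _ : ℕ => isCompact_closedBall (0 : Fin nu → ℝ) C).of_isClosed_subset
      (isClosed_tube μ x) ?_
    rintro v ⟨α, Λ, h⟩ k -
    simpa using (hC _ _ _ _ _ h).2 k
  obtain ⟨v, ⟨α, Λ, hv⟩, hmin⟩ := hcomp.exists_isMinOn ⟨s₀.v, _, _, hs₀.isTube⟩
    (continuous_J (d := d) θ x).continuousOn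
  obtain ⟨s, hs, rfl⟩ := hv.exists_feasible θ ρ
  refine ⟨s, hs, fun s' hs' => ?_⟩
  rw [hs.cost_eq, hs'.cost_eq]
  exact hmin ⟨_, _, hs'.isTube⟩

lemma IsOptimal.J_le {μ : Fin r → ℝ} {θ : Fin p → ℝ} {ρ : Reference nx nu}
    {x : Fin nx → ℝ} {s : Decision nx nu p r na m} (h : d.IsOptimal 0 μ θ ρ x s)
    {v : ℕ → Fin nu → ℝ} {α : ℕ → Fin na → ℝ} {Λ : ℕ → Fin m → Matrix (Fin na) (Fin r) ℝ}
    (hv : d.IsTube μ x v α Λ) : d.J θ x s.v ≤ d.J θ x v := by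
  obtain ⟨s', hs', rfl⟩ := hv.exists_feasible θ ρ
  rw [← h.1.cost_eq, ← hs'.cost_eq]
  exact h.2 s' hs'

/-! ## One step of the closed loop -/

/-- Componentwise suprema; nonemptiness of `S` and the bound `μ` make them genuine least upper
bounds. -/
lemma exists_isLeast_parameter_bound {S : Set (Fin p → ℝ)} {μ : Fin r → ℝ} (hS : S.Nonempty)
    (hμ : S ⊆ d.Theta μ) : ∃ μ', IsLeast {μ' : Fin r → ℝ | S ⊆ d.Theta μ'} μ' := by
  refine ⟨fun i => sSup ((fun θ => (d.MΘ *ᵥ θ) i) '' S), fun θ hθ i => ?_, fun μ' hμ' i => ?_⟩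
  · refine le_csSup ⟨μ i, ?_⟩ ⟨θ, hθ, rfl⟩
    rintro _ ⟨θ', hθ', rfl⟩
    exact hμ hθ' i
  · refine csSup_le (hS.image _) ?_
    rintro _ ⟨θ', hθ', rfl⟩
    exact hμ' hθ' i

lemma mem_unfalsified {θ : Fin p → ℝ} {x x' w : Fin nx → ℝ} {u : Fin nu → ℝ} (hw : w ∈ d.W)
    (h : x' = d.Aθ θ *ᵥ x + d.Bθ θ *ᵥ u + w) : θ ∈ d.unfalsified x' x u := by
  have : x' - d.Aθ θ *ᵥ x - d.Bθ θ *ᵥ u = w := by rw [h]; abel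
  simpa [unfalsified, this] using hw

/-- The tube of the previous step, shifted, serves the successor state. -/
lemma IsTube.next (hd : d.Standing) {μ μ' : Fin r → ℝ} {x x' w : Fin nx → ℝ}
    {v : ℕ → Fin nu → ℝ} {α : ℕ → Fin na → ℝ} {Λ : ℕ → Fin m → Matrix (Fin na) (Fin r) ℝ}
    {θ : Fin p → ℝ} (h : d.IsTube μ x v α Λ) (hθ : θ ∈ d.Theta μ) (hw : w ∈ d.W) (hμ : μ' ≤ μ)
    (hx' : x' = d.Aθ θ *ᵥ x + d.Bθ θ *ᵥ (d.K *ᵥ x + v 0) + w) :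
    ∃ α' Λ', d.IsTube μ' x' (fun k => v (k + 1)) α' Λ' := by
  have h1 := h.step_mem hd (Nat.zero_le _) hθ hw h.initial
  rw [← closedLoop_eq, ← hx'] at h1
  exact ⟨_, _, (h.shift h1).mono hμ⟩

lemma exists_norm_regD_mulVec_le (hd : d.Standing) : ∃ C : ℝ, 0 ≤ C ∧ ∀ x u η,
    d.F *ᵥ x + d.G *ᵥ u ≤ 1 → ‖d.regD x u *ᵥ η‖ ≤ C * ‖η‖ := by
  obtain ⟨z, hz0, hz⟩ := exists_Z_bound hd
  choose a ha0 ha using fun i => exists_norm_mulVec_le (d.A i)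
  choose b hb0 hb using fun i => exists_norm_mulVec_le (d.B i)
  have hs : 0 ≤ ∑ i, (a i * z + b i * z) := Finset.sum_nonneg fun i _ => by
    have := ha0 i; have := hb0 i; positivity
  refine ⟨_, hs, fun x u η h => ?_⟩
  obtain ⟨hx, hu⟩ := hz x u h
  have h1 : d.regD x u *ᵥ η = ∑ l, η l • (d.A l *ᵥ x + d.B l *ᵥ u) := by
    ext i
    simp [regD, Matrix.mulVec, dotProduct, mul_comm, mul_add]
  rw [h1, Finset.sum_mul]
  refine norm_sum_le_of_le _ fun l _ => ?_
  rw [norm_smul, mul_comm]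
  have := ha0 l
  have := hb0 l
  gcongr
  · exact (norm_add_le _ _).trans (add_le_add ((ha l x).trans (by gcongr))
      ((hb l u).trans (by gcongr)))
  · exact norm_le_pi_norm η l

end Design

/-! ### Invariants along a closed-loop trajectory -/

namespace IsClosedLoop

variable {d : Design nx nu p nc nw r na m} {γ : ℝ} {θbar : ℕ → Fin p → ℝ}
  {ref0 : (Fin nx → ℝ) → Reference nx nu} {θstar : Fin p → ℝ} {w : ℕ → Fin nx → ℝ}
  {L : Signals nx nu p r na m}

lemma theta_mem (h : IsClosedLoop d γ θbar ref0 θstar w L) (hθ : θstar ∈ d.Theta d.mu0)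
    (hw : ∀ t, w t ∈ d.W) (t : ℕ) : θstar ∈ d.Theta (L.mu t) := by
  induction t with
  | zero => rwa [h.mu_zero]
  | succ t ih =>
    exact (h.mu_step t).1 ⟨ih, fun i _ _ => Design.mem_unfalsified (hw i) (h.system i)⟩

lemma mu_succ_le (h : IsClosedLoop d γ θbar ref0 θstar w L) (t : ℕ) : L.mu (t + 1) ≤ L.mu t :=
  (h.mu_step t).2 fun _ hθ => hθ.1

lemma constraint (h : IsClosedLoop d γ θbar ref0 θstar w L) (hd : d.Standing) (t : ℕ) :
    d.F *ᵥ L.x t + d.G *ᵥ L.u t ≤ 1 := by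
  rw [h.control]
  exact (h.optimal t).1.isTube.constraint hd (Nat.zero_le _) (h.optimal t).1.initial

end IsClosedLoop

/-! ## Input-to-state stability -/

lemma le_of_contraction {V : ℕ → ℝ} {ρ D : ℝ} (hρ0 : 0 ≤ ρ) (hρ1 : ρ < 1) (hD : 0 ≤ D) (t : ℕ)
    (h : ∀ k < t, V (k + 1) ≤ ρ * V k + D) : V t ≤ ρ ^ t * V 0 + D / (1 - ρ) := by
  have h1 : 0 < 1 - ρ := by linarith
  induction t with
  | zero => simp; positivity
  | succ t ih =>
    have h2 := mul_le_mul_of_nonneg_left (ih fun k hk => h k (by omega)) hρ0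
    have h3 := h t (by omega)
    have h4 : ρ * (D / (1 - ρ)) + D = D / (1 - ρ) := by field_simp; ring
    rw [pow_succ']
    linarith

/-- Exponential input-to-state estimate in the supremum norm, with uniform constants. -/
theorem exists_iss_constants (d : Design nx nu p nc nw r na m) (hd : d.Standing) :
    ∃ a σ b c : ℝ, 0 < a ∧ 0 < σ ∧ σ < 1 ∧ 0 < b ∧ 0 < c ∧ ∀ θbar0 ∈ d.Theta d.mu0,
      ∀ ref0 θstar, θstar ∈ d.Theta d.mu0 → ∀ w : ℕ → Fin nx → ℝ, (∀ t, w t ∈ d.W) →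
      ∀ L, IsClosedLoop d 0 (fun _ => θbar0) ref0 θstar w L → ∀ t : ℕ, ∀ ω τ : ℝ,
        0 ≤ ω → 0 ≤ τ → (∀ k < t, ‖w k‖ ≤ ω ∧ ‖θbar0 - θstar‖ ≤ τ) →
        ‖L.x t‖ ≤ a * σ ^ t * ‖L.x 0‖ + b * ω + c * τ := by
  obtain ⟨c₁, hc₁, hQ⟩ := exists_le_wsq hd.Q_pos
  obtain ⟨C₂, hC₂, hub⟩ := Design.exists_quadratic_bound hd
  obtain ⟨P, hP0, hP⟩ := Design.exists_wsq_lyapP_le hd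
  obtain ⟨E, hE0, hE⟩ := Design.exists_norm_regD_mulVec_le hd
  -- Adding `c₁` keeps `c₂` positive and makes `ε ≤ 1`.
  set c₂ := C₂ + c₁ with hc₂
  have hc₂0 : 0 < c₂ := by positivity
  set ε := c₁ / c₂ with hε
  have hε0 : 0 < ε := by positivity
  have hε1 : ε ≤ 1 := (div_le_one hc₂0).2 (by linarith)
  -- Small enough that the Young factor leaves a contraction: `(1 + δ)(1 - ε) ≤ 1 - δ`.
  set δ := ε / 2 with hδ
  have hδ0 : 0 < δ := by positivity
  set ρ := 1 - δ with hρ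
  have hρ0 : 0 < ρ := by linarith
  have hρ1 : ρ < 1 := by linarith
  set g := (1 + δ⁻¹) * P / (c₁ * (1 - ρ)) with hg
  have h1ρ : 0 < 1 - ρ := by linarith
  have hg0 : 0 ≤ g := by positivity
  refine ⟨√(c₂ / c₁), √ρ, √g + 1, (√g + 1) * (E + 1), by positivity, by positivity,
    by rw [Real.sqrt_lt' one_pos]; simpa using hρ1, by positivity, by positivity,
    fun θbar0 hθbar ref0 θstar hθstar w hw L hL t ω τ hω0 hτ0 hωτ => ?_⟩
  have htube := fun t => (hL.optimal t).1.isTube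
  set V : ℕ → ℝ := fun t => d.J θbar0 (L.x t) (L.sol t).v with hV
  have hlow : ∀ t, c₁ * ‖L.x t‖ ^ 2 ≤ V t := fun t =>
    (hQ _).trans (Design.wsq_Q_le_J hd hθbar _ _)
  have hupp : ∀ t, V t ≤ c₂ * ‖L.x t‖ ^ 2 := by
    intro t
    obtain ⟨v', α', Λ', h1, h2⟩ := hub θbar0 hθbar (L.mu t) θstar (hL.theta_mem hθstar hw t) hθstar
      _ _ _ _ (htube t)
    refine ((hL.optimal t).J_le h1).trans (h2.trans ?_)
    gcongr; linarith
  set M := ω + E * τ with hM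
  have hM0 : 0 ≤ M := by positivity
  have hdec : ∀ k < t, V (k + 1) ≤ ρ * V k + (1 + δ⁻¹) * P * M ^ 2 := by
    intro k hk
    -- One-step prediction error: parameter mismatch enters as an additive disturbance, with bounded
    -- gain because `(x, u) ∈ Z`.
    set e := d.regD (L.x k) (L.u k) *ᵥ (θstar - θbar0) + w k with he
    have hx : L.x (k + 1) = d.nom θbar0 (L.x k) (L.sol k).v 1 + e := by
      have h1 := Design.regD_mulVec_add_regd (d := d) θstar (L.x k) (L.u k)
      have h2 := Design.regD_mulVec_add_regd (d := d) θbar0 (L.x k) (L.u k)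
      have h3 : d.nom θbar0 (L.x k) (L.sol k).v 1
          = d.Aθ θbar0 *ᵥ L.x k + d.Bθ θbar0 *ᵥ L.u k := by
        rw [hL.control, Design.closedLoop_eq]; rfl
      rw [hL.system, ← h1, h3, ← h2, he, Matrix.mulVec_sub]
      abel
    have heM : ‖e‖ ≤ M := by
      refine (norm_add_le _ _).trans ?_
      have h1 := hE _ _ (θstar - θbar0) (hL.constraint hd k)
      rw [norm_sub_rev] at h1
      have h2 := mul_le_mul_of_nonneg_left (hωτ k hk).2 hE0
      linarith [(hωτ k hk).1]
    obtain ⟨α', Λ', h'⟩ := (htube k).next hd (hL.theta_mem hθstar hw k) (hw k) (hL.mu_succ_le k)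
      (x' := L.x (k + 1)) (by rw [hL.system, hL.control])
    have h1 := (hL.optimal (k + 1)).J_le h'
    have h2 := Design.J_add_le hd hθbar hδ0 (d.nom θbar0 (L.x k) (L.sol k).v 1) e
      (fun k' => (L.sol k).v (k' + 1))
    rw [← hx, Design.J_shift hd hθbar _ ((htube k).v_tail _ le_rfl)] at h2
    have h3 : wsq (d.lyapP θbar0) e ≤ P * M ^ 2 := (hP θbar0 hθbar e).2.trans (by gcongr)
    have h4 : ε * V k ≤ c₁ * ‖L.x k‖ ^ 2 := by
      rw [hε, div_mul_eq_mul_div, div_le_iff₀ hc₂0, mul_assoc]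
      gcongr
      rw [mul_comm]; exact hupp k
    have h5 := hQ (L.x k)
    have h6 := wsq_nonneg hd.R_pos (d.K *ᵥ L.x k + (L.sol k).v 0)
    have hV0 : 0 ≤ V k := le_trans (by positivity) (hlow k)
    calc V (k + 1) ≤ _ := h1.trans h2
      _ ≤ (1 + δ) * (V k - ε * V k) + (1 + δ⁻¹) * (P * M ^ 2) := by
          gcongr
          linarith
      _ ≤ ρ * V k + (1 + δ⁻¹) * P * M ^ 2 := by
          have h7 : (1 + δ) * (V k - ε * V k) ≤ ρ * V k := by
            have : (1 + δ) * (1 - ε) ≤ ρ := by rw [hρ, hδ]; nlinarith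
            nlinarith
          linarith
  have hfin := le_of_contraction hρ0.le hρ1 (by positivity) t hdec
  have hsq : ‖L.x t‖ ^ 2 ≤ (√(c₂ / c₁) * √ρ ^ t * ‖L.x 0‖) ^ 2 + (√g * M) ^ 2 := by
    have h1 : (√(c₂ / c₁) * √ρ ^ t * ‖L.x 0‖) ^ 2 = c₂ / c₁ * ρ ^ t * ‖L.x 0‖ ^ 2 := by
      rw [mul_pow, mul_pow, ← pow_mul, mul_comm t 2, pow_mul, Real.sq_sqrt (by positivity),
        Real.sq_sqrt hρ0.le]
    rw [h1, mul_pow, Real.sq_sqrt hg0, hg]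
    have h2 : ρ ^ t * V 0 ≤ ρ ^ t * (c₂ * ‖L.x 0‖ ^ 2) := by gcongr; exact hupp 0
    have h3 := (hlow t).trans hfin
    have h4 : c₁ * (c₂ / c₁ * ρ ^ t * ‖L.x 0‖ ^ 2 + (1 + δ⁻¹) * P / (c₁ * (1 - ρ)) * M ^ 2)
        = ρ ^ t * (c₂ * ‖L.x 0‖ ^ 2) + (1 + δ⁻¹) * P * M ^ 2 / (1 - ρ) := by
      field_simp
    refine le_of_mul_le_mul_left ?_ hc₁
    linarith
  have hA : 0 ≤ √(c₂ / c₁) * √ρ ^ t * ‖L.x 0‖ := by positivity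
  have hB : 0 ≤ √g * M := by positivity
  have h1 : ‖L.x t‖ ≤ √(c₂ / c₁) * √ρ ^ t * ‖L.x 0‖ + √g * M :=
    le_of_sq_le_sq (by nlinarith) (by positivity)
  have h2 : √g * M ≤ (√g + 1) * ω + (√g + 1) * (E + 1) * τ := by
    rw [hM]
    have := Real.sqrt_nonneg g
    nlinarith [mul_nonneg this hτ0, mul_nonneg hE0 hτ0]
  linarith

/-! ## Existence of trajectories -/

/-- Construction of a sequence by dependent choice with conditions on the whole history. -/
lemma exists_seq_of_history {σ : Type*} (P : ℕ → (ℕ → σ) → Prop)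
    (hloc : ∀ n f g, (∀ i ≤ n, f i = g i) → P n f → P n g) (f₀ : ℕ → σ) (h0 : P 0 f₀)
    (hs : ∀ n f, (∀ k ≤ n, P k f) → ∃ s, P (n + 1) (Function.update f (n + 1) s)) :
    ∃ f, f 0 = f₀ 0 ∧ ∀ n, P n f := by
  have hs' : ∀ n (f : {f : ℕ → σ // ∀ k ≤ n, P k f}),
      ∃ f' : {f : ℕ → σ // ∀ k ≤ n + 1, P k f}, ∀ i ≤ n, f'.1 i = f.1 i := by
    rintro n ⟨f, hf⟩
    obtain ⟨s, hs⟩ := hs n f hf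
    have he : ∀ i ≤ n, Function.update f (n + 1) s i = f i := fun i hi =>
      Function.update_of_ne (by omega) _ _
    refine ⟨⟨Function.update f (n + 1) s, fun k hk => ?_⟩, he⟩
    rcases hk.lt_or_eq with hk | rfl
    · exact hloc k f _ (fun i hi => (he i (by omega)).symm) (hf k (by omega))
    · exact hs
  choose next hnext using hs'
  let F : ∀ n, {f : ℕ → σ // ∀ k ≤ n, P k f} := fun n =>
    Nat.rec ⟨f₀, fun k hk => by rwa [Nat.le_zero.1 hk]⟩ (fun n f => next n f) n
  have hF : ∀ i k, (F (i + k)).1 i = (F i).1 i := by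
    intro i k
    induction k with
    | zero => rfl
    | succ k ih => exact (hnext (i + k) (F (i + k)) i (by omega)).trans ih
  refine ⟨fun n => (F n).1 n, rfl, fun n => hloc n (F n).1 _ (fun i hi => ?_) ((F n).2 n le_rfl)⟩
  obtain ⟨k, rfl⟩ := Nat.exists_eq_add_of_le hi
  exact hF i k

/-- The signals at one time. -/
structure Snapshot (nx nu p r na m : ℕ) where
  x : Fin nx → ℝ
  u : Fin nu → ℝ
  mu : Fin r → ℝ
  ref : Reference nx nu
  sol : Decision nx nu p r na m

namespace Design

variable {d : Design nx nu p nc nw r na m}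

/-- The reference generated from the state `x` and the perturbations `v`. -/
lemma exists_reference (d : Design nx nu p nc nw r na m) (θ : Fin p → ℝ) (x : Fin nx → ℝ)
    (v : ℕ → Fin nu → ℝ) : ∃ ρ : Reference nx nu, ρ.xhat 0 = x ∧
      (∀ k, ρ.xhat (k + 1) = d.Aθ θ *ᵥ ρ.xhat k + d.Bθ θ *ᵥ ρ.uhat k) ∧
      ∀ k, ρ.uhat k = d.K *ᵥ ρ.xhat k + v k :=
  ⟨⟨d.nom θ x v, fun k => d.K *ᵥ d.nom θ x v k + v k⟩, rfl,
    fun _ => (closedLoop_eq _ _ _).symm, fun _ => rfl⟩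

/-- The parameters compatible with the history up to time `n + 1`. -/
def unfalsifiedSet (d : Design nx nu p nc nw r na m) (f : ℕ → Snapshot nx nu p r na m) (n : ℕ) :
    Set (Fin p → ℝ) :=
  {θ ∈ d.Theta (f n).mu | ∀ i ≤ n, n < i + d.Nu →
    θ ∈ d.unfalsified (f (i + 1)).x (f i).x (f i).u}

lemma unfalsifiedSet_congr {f g : ℕ → Snapshot nx nu p r na m} {n : ℕ}
    (h : ∀ i ≤ n + 1, f i = g i) : d.unfalsifiedSet f n = d.unfalsifiedSet g n := by
  ext θ
  refine and_congr (by rw [h n (by omega)]) (forall₂_congr fun i hi => ?_)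
  rw [h i (by omega), h (i + 1) (by omega)]

/-- The conditions on the snapshot at time `n` of a closed-loop trajectory. -/
def StepCondition (d : Design nx nu p nc nw r na m) (θbar : Fin p → ℝ)
    (ref0 : (Fin nx → ℝ) → Reference nx nu) (θstar : Fin p → ℝ) (w : ℕ → Fin nx → ℝ)
    (n : ℕ) (f : ℕ → Snapshot nx nu p r na m) : Prop :=
  θstar ∈ d.Theta (f n).mu ∧ d.IsOptimal 0 (f n).mu θbar (f n).ref (f n).x (f n).sol ∧
  (f n).u = d.K *ᵥ (f n).x + (f n).sol.v 0 ∧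
  match n with
  | 0 => (f 0).mu = d.mu0 ∧ (f 0).ref = ref0 (f 0).x
  | n + 1 => (f (n + 1)).x = d.Aθ θstar *ᵥ (f n).x + d.Bθ θstar *ᵥ (f n).u + w n ∧
      IsLeast {μ : Fin r → ℝ | d.unfalsifiedSet f n ⊆ d.Theta μ} (f (n + 1)).mu ∧
      (f (n + 1)).ref.xhat 0 = (f (n + 1)).x ∧
      (∀ k, (f (n + 1)).ref.xhat (k + 1) = d.Aθ θbar *ᵥ (f (n + 1)).ref.xhat k
        + d.Bθ θbar *ᵥ (f (n + 1)).ref.uhat k) ∧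
      ∀ k, (f (n + 1)).ref.uhat k = d.K *ᵥ (f (n + 1)).ref.xhat k
        + (if k + 1 < d.N then (f n).sol.v (k + 1) else 0)

lemma StepCondition.congr {θbar : Fin p → ℝ} {ref0 : (Fin nx → ℝ) → Reference nx nu}
    {θstar : Fin p → ℝ} {w : ℕ → Fin nx → ℝ} {n : ℕ} {f g : ℕ → Snapshot nx nu p r na m}
    (h : ∀ i ≤ n, f i = g i) (hf : d.StepCondition θbar ref0 θstar w n f) :
    d.StepCondition θbar ref0 θstar w n g := by
  cases n with
  | zero => simpa only [StepCondition, h 0 le_rfl] using hf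
  | succ n =>
    simpa only [StepCondition, h (n + 1) le_rfl, h n n.le_succ, unfalsifiedSet_congr h] using hf

/-- `StepCondition` carries `θstar ∈ Θ_n` along, which makes the unfalsified set nonempty, so that a
least `μ` exists, and the shifted tube feasible. -/
theorem exists_closedLoop (hd : d.Standing) {θbar : Fin p → ℝ}
    {ref0 : (Fin nx → ℝ) → Reference nx nu} {θstar : Fin p → ℝ} (hθ : θstar ∈ d.Theta d.mu0)
    {w : ℕ → Fin nx → ℝ} (hw : ∀ t, w t ∈ d.W) {x0 : Fin nx → ℝ}
    (hx0 : x0 ∈ d.feasibleSet θbar ref0) :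
    ∃ L, IsClosedLoop d 0 (fun _ => θbar) ref0 θstar w L ∧ L.x 0 = x0 := by
  obtain ⟨s0, hs0⟩ := exists_isOptimal hd hx0
  obtain ⟨f, hf0, hf⟩ := exists_seq_of_history (d.StepCondition θbar ref0 θstar w)
    (fun n f g h => StepCondition.congr h)
    (fun _ => ⟨x0, d.K *ᵥ x0 + s0.v 0, d.mu0, ref0 x0, s0⟩) ⟨hθ, hs0, rfl, rfl, rfl⟩ <| by
    intro n f hf
    obtain ⟨x', hx'⟩ : ∃ x', x' = d.Aθ θstar *ᵥ (f n).x + d.Bθ θstar *ᵥ (f n).u + w n := ⟨_, rfl⟩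
    -- The unfalsified set of the extended history, written with the new state `x'` alone because
    -- the new snapshot itself depends on this set.
    set S : Set (Fin p → ℝ) := {θ ∈ d.Theta (f n).mu | ∀ i ≤ n, n < i + d.Nu →
      θ ∈ d.unfalsified (if i = n then x' else (f (i + 1)).x) (f i).x (f i).u} with hS
    have hmem : θstar ∈ S := by
      refine ⟨(hf n le_rfl).1, fun i hi _ => ?_⟩
      split_ifs with h
      · subst h; exact mem_unfalsified (hw i) hx'
      · exact mem_unfalsified (hw i) (hf (i + 1) (by omega)).2.2.2.1
    obtain ⟨μ, hμ⟩ := exists_isLeast_parameter_bound ⟨_, hmem⟩ (fun θ hθ => hθ.1 : S ⊆ _)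
    obtain ⟨ρ, hρ0, hρ1, hρ2⟩ := exists_reference d θbar x'
      (fun k => if k + 1 < d.N then (f n).sol.v (k + 1) else 0)
    obtain ⟨-, hopt, hu, -⟩ := hf n le_rfl
    obtain ⟨α', Λ', h'⟩ := hopt.1.isTube.next hd (hf n le_rfl).1 (hw n) (hμ.2 fun θ hθ => hθ.1)
      (x' := x')       (by rw [← hu]; exact hx')
    obtain ⟨s', hs', -⟩ := h'.exists_feasible θbar ρ
    obtain ⟨s, hs⟩ := exists_isOptimal hd ⟨s', hs'⟩
    refine ⟨⟨x', d.K *ᵥ x' + s.v 0, μ, ρ, s⟩, ?_⟩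
    have hn : ∀ i ≤ n, Function.update f (n + 1) ⟨x', d.K *ᵥ x' + s.v 0, μ, ρ, s⟩ i = f i :=
      fun i hi => Function.update_of_ne (by omega) _ _
    have hset : d.unfalsifiedSet
        (Function.update f (n + 1) ⟨x', d.K *ᵥ x' + s.v 0, μ, ρ, s⟩) n = S := by
      ext θ
      refine and_congr (by rw [hn n le_rfl]) (forall₂_congr fun i hi => ?_)
      rw [hn i hi]
      split_ifs with h
      · subst h; rw [Function.update_self]
      · rw [hn (i + 1) (by omega)]
    simp only [StepCondition, hset, hn n le_rfl, Function.update_self]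
    exact ⟨hμ.1 hmem, hs, trivial, hx', hμ, hρ0, hρ1, hρ2⟩
  refine ⟨⟨fun t => (f t).x, fun t => (f t).u, fun t => (f t).mu, fun t => (f t).ref,
    fun t => (f t).sol⟩, ?_, by simp [hf0]⟩
  have hf1 := fun t => (hf (t + 1)).2.2.2
  exact ⟨fun t => (hf1 t).1, (hf 0).2.2.2.1, fun t => (hf1 t).2.1, (hf 0).2.2.2.2,
    fun t => (hf1 t).2.2.1, fun t => (hf1 t).2.2.2.1, fun t => (hf1 t).2.2.2.2,
    fun t => (hf t).2.1, fun t => (hf t).2.2.1⟩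

/-- The terminal section of a single feasible tube contains `W`, so holding it constant with `v = 0`
serves every initial state in `W`. -/
lemma zero_mem_interior_feasibleSet (hd : d.Standing) {θbar : Fin p → ℝ}
    (hθ : θbar ∈ d.Theta d.mu0) {ref0 : (Fin nx → ℝ) → Reference nx nu}
    (h : (d.feasibleSet θbar ref0).Nonempty) :
    (0 : Fin nx → ℝ) ∈ interior (d.feasibleSet θbar ref0) := by
  obtain ⟨x, s, hs⟩ := h
  rw [mem_interior_iff_mem_nhds]
  filter_upwards [W_mem_nhds hd] with y hy
  obtain ⟨s', hs', -⟩ :=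
    (hs.isTube.terminal (hs.isTube.W_subset hd hθ hθ hy)).exists_feasible θbar (ref0 y)
  exact ⟨s', hs'⟩

end Design

/-! ## Comparison functions and the Euclidean norm -/

lemma isClassK_const_mul {b : ℝ≥0} (hb : 0 < b) : IsClassK fun s => b * s :=
  ⟨by fun_prop, fun _ _ h => mul_lt_mul_of_pos_left h hb, mul_zero b⟩

lemma isClassKL_exp {a σ : ℝ≥0} (ha : 0 < a) (hσ : 0 < σ) (hσ1 : σ < 1) :
    IsClassKL fun s t => a * σ ^ (t : ℝ) * s := by
  have hlim : Tendsto (fun t : ℝ≥0 => σ ^ (t : ℝ)) atTop (𝓝 0) := by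
    rw [← NNReal.tendsto_coe]
    simp only [NNReal.coe_rpow, NNReal.coe_zero]
    exact (tendsto_rpow_atTop_of_base_lt_one (σ : ℝ) (by have : (0 : ℝ) < σ := hσ; linarith)
      hσ1).comp (NNReal.tendsto_coe_atTop.2 tendsto_id)
  refine ⟨?_, fun t => isClassK_const_mul (mul_pos ha (NNReal.rpow_pos hσ)), fun s => ⟨?_, ?_⟩⟩
  · have : Continuous fun q : ℝ≥0 × ℝ≥0 => σ ^ (q.2 : ℝ) := by
      refine continuous_iff_continuousAt.2 fun q => ?_
      exact (NNReal.continuousAt_rpow (Or.inl hσ.ne')).comp_of_eq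
        (f := fun q : ℝ≥0 × ℝ≥0 => (σ, (q.2 : ℝ))) (by fun_prop) rfl
    fun_prop
  · intro t t' htt'
    have := NNReal.rpow_le_rpow_of_exponent_ge hσ hσ1.le (NNReal.coe_le_coe.2 htt')
    dsimp only
    gcongr
  · simpa using (hlim.const_mul a).mul_const s

lemma norm_le_euclNorm {n : ℕ} (x : Fin n → ℝ) : ‖x‖ ≤ euclNorm x :=
  (pi_norm_le_iff_of_nonneg (NNReal.coe_nonneg _)).2 fun i =>
    PiLp.norm_apply_le (WithLp.toLp 2 x) i

lemma euclNorm_le {n : ℕ} (x : Fin n → ℝ) : (euclNorm x : ℝ) ≤ √n * ‖x‖ := by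
  rw [euclNorm, coe_nnnorm, EuclideanSpace.norm_eq]
  rw [← Real.sqrt_sq (norm_nonneg x), ← Real.sqrt_mul n.cast_nonneg]
  refine Real.sqrt_le_sqrt ?_
  calc ∑ i, ‖x i‖ ^ 2 ≤ ∑ _i : Fin n, ‖x‖ ^ 2 :=
        Finset.sum_le_sum fun i _ => by gcongr; exact norm_le_pi_norm x i
    _ = n * ‖x‖ ^ 2 := by simp

end AdaptiveMPC

theorem mainTheorem3 {nx nu p nc nw r na m : ℕ}
    (d : AdaptiveMPC.Design nx nu p nc nw r na m) (hd : d.Standing) :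
    ∃ (η : ℝ≥0 → ℝ≥0 → ℝ≥0) (ψ ζ : ℝ≥0 → ℝ≥0),
      AdaptiveMPC.IsClassKL η ∧ AdaptiveMPC.IsClassK ψ ∧ AdaptiveMPC.IsClassK ζ ∧
      ∀ θbar0 ∈ d.Theta d.mu0,
      ∀ ref0 : (Fin nx → ℝ) → AdaptiveMPC.Reference nx nu,
      (d.feasibleSet θbar0 ref0).Nonempty →
        (0 : Fin nx → ℝ) ∈ interior (d.feasibleSet θbar0 ref0) ∧
        ∀ θstar ∈ d.Theta d.mu0,
        ∀ w : ℕ → Fin nx → ℝ, (∀ t, w t ∈ d.W) →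
        ∀ x0 ∈ d.feasibleSet θbar0 ref0,
          (∃ L, AdaptiveMPC.IsClosedLoop d 0 (fun _ => θbar0) ref0 θstar w L ∧ L.x 0 = x0) ∧
          ∀ L, AdaptiveMPC.IsClosedLoop d 0 (fun _ => θbar0) ref0 θstar w L → L.x 0 = x0 →
            (∀ t, d.IsFeasible (L.mu t) θbar0 (L.ref t) (L.x t)) ∧
            (∀ t, d.F *ᵥ L.x t + d.G *ᵥ L.u t ≤ 1) ∧
            AdaptiveMPC.ISSBound η ψ ζ L.x w (fun _ => θbar0) θstar := by
  obtain ⟨a, σ, b, c, ha, hσ0, hσ1, hb, hc, hbound⟩ := AdaptiveMPC.exists_iss_constants d hd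
  -- `s` converts the supremum norm to the Euclidean one; it must be positive even when `nx = 0` for
  -- the gains to be of class `K`.
  obtain ⟨s, hs0, hs⟩ : ∃ s : ℝ≥0, 0 < s ∧ √nx ≤ s :=
    ⟨NNReal.sqrt nx + 1, by positivity, by simp [Real.coe_sqrt]⟩
  lift a to ℝ≥0 using ha.le
  lift σ to ℝ≥0 using hσ0.le
  lift b to ℝ≥0 using hb.le
  lift c to ℝ≥0 using hc.le
  rw [NNReal.coe_pos] at ha hσ0 hb hc
  refine ⟨fun q t => s * a * σ ^ (t : ℝ) * q, fun q => s * b * q, fun q => s * c * q,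
    AdaptiveMPC.isClassKL_exp (mul_pos hs0 ha) hσ0 (by exact_mod_cast hσ1),
    AdaptiveMPC.isClassK_const_mul (mul_pos hs0 hb),
    AdaptiveMPC.isClassK_const_mul (mul_pos hs0 hc),
    fun θbar0 hθbar ref0 hne => ⟨AdaptiveMPC.Design.zero_mem_interior_feasibleSet hd hθbar hne,
    fun θstar hθ w hw x0 hx0 => ⟨AdaptiveMPC.Design.exists_closedLoop hd hθ hw hx0,
    fun L hL _ => ⟨fun t => ⟨_, (hL.optimal t).1⟩, hL.constraint hd, fun t => ?_⟩⟩⟩⟩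
  rw [← NNReal.coe_le_coe]
  set ω : ℝ≥0 := (Finset.range t).sup fun k => AdaptiveMPC.euclNorm (w k)
  set τ : ℝ≥0 := (Finset.range t).sup fun _ => AdaptiveMPC.euclNorm (θbar0 - θstar)
  have hmain : ‖L.x t‖ ≤ a * σ ^ t * ‖L.x 0‖ + b * ω + c * τ := by
    refine hbound θbar0 hθbar ref0 θstar hθ w hw L hL t ω τ ω.2 τ.2 fun k hk => ⟨?_, ?_⟩
    · exact (AdaptiveMPC.norm_le_euclNorm _).trans <| NNReal.coe_le_coe.2 <|
        Finset.le_sup (f := fun k => AdaptiveMPC.euclNorm (w k)) (Finset.mem_range.2 hk)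
    · exact (AdaptiveMPC.norm_le_euclNorm _).trans <| NNReal.coe_le_coe.2 <|
        Finset.le_sup (f := fun _ => AdaptiveMPC.euclNorm (θbar0 - θstar)) (Finset.mem_range.2 hk)
  have hx0 := AdaptiveMPC.norm_le_euclNorm (L.x 0)
  calc (AdaptiveMPC.euclNorm (L.x t) : ℝ) ≤ √nx * ‖L.x t‖ := AdaptiveMPC.euclNorm_le _
    _ ≤ s * (a * σ ^ t * ‖L.x 0‖ + b * ω + c * τ) := by
        gcongr
    _ ≤ s * (a * σ ^ t * AdaptiveMPC.euclNorm (L.x 0) + b * ω + c * τ) := by gcongr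
    _ = _ := by push_cast; rw [Real.rpow_natCast]; ring
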